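/- Let $d\in\{3,4,5\}$ and let $0<\sigma<1$ be such that $1<\frac d2-\sigma<2$. Let $g$ be a (complex-valued) Schwartz function on $\mathbb{R}^d$. For $x\in\mathbb{R}^d$ and $t>0$ put $$u(x,t)=\frac{\sigma\,\sin\big((\frac d2-\sigma-1)\pi\big)\,\Gamma(\frac d2-\sigma-1)}{2\pi^{d/2}\,\sin(\sigma\pi)\,\Gamma(1-\sigma)}\;\frac1{t^2}\int_{B(x,t)}\frac{2(\sigma+1)g(y)+(y-x)\cdot\nabla g(y)}{(t^2-|x-y|^2)^{\frac d2-\sigma-1}}\,dy ,$$ where $B(x,t)$ is the open ball; the integral converges absolutely. Then $u$ is a solution of the Neumann problem $$\partial_t^2u+\frac{1-2\sigma}{t}\,\partial_tu=\Delta u\quad(t>0),\qquad u(\cdot,0)=0,\qquad \partial_t^\sigma u(\cdot,0)=g,\qquad\text{where } \partial_t^\sigma=\frac1{2\sigma}\,t^{1-2\sigma}\,\partial_t .$$ It is a solution in both of the following senses. (i) Classically: $u\in C^2(\mathbb{R}^d\times(0,\infty))$, the equation holds at every point, and for every $x$ one has $u(x,t)\to0$ and $\partial_t^\sigma u(x,t)\to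 g(x)$ as $t\to0^+$. (ii) Weakly in $L^2(\mathbb{R}^d)$: for every $t>0$ the function $u(\cdot,t)$ lies in the domain of $\Delta$ on $L^2(\mathbb{R}^d)$ (that is, $u(\cdot,t)$ and its distributional Laplacian are in $L^2$), and for every $h\in L^2(\mathbb{R}^d)$ the function $t\mapsto\langle u(\cdot,t),h\rangle$ is $C^2$ on $(0,\infty)$ and satisfies $(\partial_t^2+\frac{1-2\sigma}{t}\partial_t)\langle u(\cdot,t),h\rangle=\langle\Delta u(\cdot,t),h\rangle$ for $t>0$, together with $\langle u(\cdot,t),h\rangle\to0$ and $\partial_t^\sigma\langle u(\cdot,t),h\rangle\to\langle g,h\rangle$ as $t\to0^+$. -/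

import Mathlib

open MeasureTheory Set Filter Topology
open scoped ContDiff SchwartzMap ComplexConjugate

namespace WaveExtension

/-- The operator `∂_t^σ = (2σ)⁻¹ t^(1-2σ) ∂_t` acting on functions of time. -/
noncomputable def fracTimeDeriv (σ : ℝ) (f : ℝ → ℂ) (t : ℝ) : ℂ :=
  (((1 / (2 * σ)) * t ^ (1 - 2 * σ) : ℝ) : ℂ) * deriv f t

/-- The operator `∂_t² + ((1-2σ)/t) ∂_t` acting on functions of time. -/
noncomputable def besselTimeOp (σ : ℝ) (f : ℝ → ℂ) (t : ℝ) : ℂ :=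
  deriv (deriv f) t + (((1 - 2 * σ) / t : ℝ) : ℂ) * deriv f t

/-- The pairing `⟨f, h⟩ = ∫ f(x) conj(h(x)) dx`, used below only for `f, h ∈ L²`. -/
noncomputable def pairing {d : ℕ} (f h : EuclideanSpace ℝ (Fin d) → ℂ) : ℂ :=
  ∫ x, f x * conj (h x)

/-- `v = Δ f` in the weak (distributional) sense. For `f, v ∈ L²(ℝ^d)` this says precisely that
`f` lies in the domain of the self-adjoint operator `Δ` on `L²(ℝ^d)` and `Δ f = v`. -/
def IsWeakLaplacian {d : ℕ} (f v : EuclideanSpace ℝ (Fin d) → ℂ) : Prop :=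
  ∀ φ : EuclideanSpace ℝ (Fin d) → ℂ, ContDiff ℝ ∞ φ → HasCompactSupport φ →
    ∫ x, f x * Laplacian.laplacian φ x = ∫ x, v x * φ x

/-- `u` is a classical (pointwise) solution of the Neumann problem
`∂_t² u + ((1-2σ)/t) ∂_t u = Δ u` for `t > 0`, `u(·,0) = 0`, `∂_t^σ u(·,0) = g`. -/
structure IsClassicalNeumannSolution {d : ℕ} (σ : ℝ) (g : EuclideanSpace ℝ (Fin d) → ℂ)
    (u : EuclideanSpace ℝ (Fin d) → ℝ → ℂ) : Prop where
  contDiffOn : ContDiffOn ℝ 2 (fun p : EuclideanSpace ℝ (Fin d) × ℝ => u p.1 p.2)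
    (univ ×ˢ Ioi (0 : ℝ))
  equation : ∀ x, ∀ t : ℝ, 0 < t →
    besselTimeOp σ (fun s => u x s) t = Laplacian.laplacian (fun y => u y t) x
  initial : ∀ x, Tendsto (fun t => u x t) (𝓝[>] 0) (𝓝 0)
  neumann : ∀ x, Tendsto (fun t => fracTimeDeriv σ (fun s => u x s) t) (𝓝[>] 0) (𝓝 (g x))

/-- `u` is a weak solution in `L²(ℝ^d)` of the same Neumann problem: for each `t > 0`, `u(·,t)`
lies in the domain of `Δ` on `L²`, and for all `h ∈ L²` one has
`(∂_t² + ((1-2σ)/t) ∂_t) ⟨u(·,t), h⟩ = ⟨Δ u(·,t), h⟩` for `t > 0`, while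
`⟨u(·,t), h⟩ → 0` and `∂_t^σ ⟨u(·,t), h⟩ → ⟨g, h⟩` as `t → 0+`. -/
structure IsWeakNeumannSolution {d : ℕ} (σ : ℝ) (g : EuclideanSpace ℝ (Fin d) → ℂ)
    (u : EuclideanSpace ℝ (Fin d) → ℝ → ℂ) : Prop where
  memLp : ∀ t : ℝ, 0 < t → MemLp (fun x => u x t) 2 volume
  contDiffOn : ∀ h : EuclideanSpace ℝ (Fin d) → ℂ, MemLp h 2 volume →
    ContDiffOn ℝ 2 (fun t => pairing (fun x => u x t) h) (Ioi (0 : ℝ))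
  equation : ∀ t : ℝ, 0 < t → ∃ v : EuclideanSpace ℝ (Fin d) → ℂ, MemLp v 2 volume ∧
    IsWeakLaplacian (fun x => u x t) v ∧
    ∀ h : EuclideanSpace ℝ (Fin d) → ℂ, MemLp h 2 volume →
      besselTimeOp σ (fun s => pairing (fun x => u x s) h) t = pairing v h
  initial : ∀ h : EuclideanSpace ℝ (Fin d) → ℂ, MemLp h 2 volume →
    Tendsto (fun t => pairing (fun x => u x t) h) (𝓝[>] 0) (𝓝 0)
  neumann : ∀ h : EuclideanSpace ℝ (Fin d) → ℂ, MemLp h 2 volume →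
    Tendsto (fun t => fracTimeDeriv σ (fun s => pairing (fun x => u x s) h) t)
      (𝓝[>] 0) (𝓝 (pairing g h))

/-- The integrand `(2(σ+1) g(y) + (y-x)·∇g(y)) / (t² - |x-y|²)^(d/2-σ-1)`; the directional
derivative `(y-x)·∇g(y)` is the Fréchet derivative of `g` at `y` applied to `y - x`. -/
noncomputable def kernelIntegrand {d : ℕ} (σ : ℝ) (g : EuclideanSpace ℝ (Fin d) → ℂ)
    (x : EuclideanSpace ℝ (Fin d)) (t : ℝ) (y : EuclideanSpace ℝ (Fin d)) : ℂ :=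
  (((2 * (σ + 1) : ℝ) : ℂ) * g y + fderiv ℝ g y (y - x)) /
    (((t ^ 2 - ‖x - y‖ ^ 2) ^ ((d : ℝ) / 2 - σ - 1) : ℝ) : ℂ)

/-- The constant in front of the kernel representation. -/
noncomputable def kernelConst (d : ℕ) (σ : ℝ) : ℝ :=
  σ * Real.sin (((d : ℝ) / 2 - σ - 1) * Real.pi) * Real.Gamma ((d : ℝ) / 2 - σ - 1) /
    (2 * Real.pi ^ ((d : ℝ) / 2) * Real.sin (σ * Real.pi) * Real.Gamma (1 - σ))

end WaveExtension

/-! Put α = d/2 - σ - 1 and β = 1 - α, both in (0,1), and w_γ(z) = (1 - |z|²)^γ on the unit ball,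
zero outside. Substituting y = x + tz turns (y - x)·∇g into t ∂_t of g(x + tz), and the formula
becomes u = C t^(2σ) N_g. Here N_ψ = (2σ+2) A_ψ + t ∂_t A_ψ, and A_ψ(x,t) is the integral of
w_(β-1)(z) ψ(x + tz) (`kernelIntegrand_add_smul`, `kernel_representation_eq`).

The crux is ∂_t N_ψ = t A_(Δψ) (`hasDerivAt_profile`). Let B_ψ be the average against w_β. Since
∇w_β = -2β z w_(β-1), integration by parts gives t B_(Δψ) = 2β ∂_t A_ψ (`mul_avg_laplacian`).
Combined with w_(β-1) = w_β + |z|² w_(β-1), it also gives 2β A_ψ = (d + 2β) B_ψ + t ∂_t B_ψ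
(`avg_ballWeight_sub_one`). The crux follows from d + 2β = 2σ + 4.

The rest is one-variable calculus. If n' = t l, the operator ∂_t² + ((1-2σ)/t) ∂_t sends t^(2σ) n to
t^(2σ) ((2σ+2) l + t l') (`besselTimeOp_rpow_mul`). With n = N_g and l = A_(Δg), this is t^(2σ)
N_(Δg) = Δ(t^(2σ) N_g). At t = 0 the Neumann datum is C (2σ+2) (∫ w_(β-1)) g, and the Beta integral
with the reflection formula shows that the factor is 1 (`kernelConst_mul_integral_ballWeight`).

The weak statement applies the same calculus to t ↦ ⟨N_g(·,t), h⟩. Averages of Schwartz functions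
decay in x locally uniformly in t, so pairing with h commutes with ∂_t (`hasDerivAt_pairing`). -/

namespace WaveExtension
open LineDeriv

variable {d : ℕ}

/-! ### Weighted averages over the unit ball: differentiation under the integral -/

/-- An integrable function on `ℝ^d` vanishing outside the closed unit ball. -/
structure IsBallWeight (W : EuclideanSpace ℝ (Fin d) → ℝ) : Prop where
  integrable : Integrable W volume
  eq_zero : ∀ z, 1 < ‖z‖ → W z = 0

theorem IsBallWeight.mul_coord {W : EuclideanSpace ℝ (Fin d) → ℝ} (hW : IsBallWeight W)
    (i : Fin d) : IsBallWeight (fun z => W z * z i) where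
  integrable := by
    refine hW.integrable.mono (hW.integrable.aestronglyMeasurable.mul
      (Continuous.aestronglyMeasurable (by fun_prop))) (Eventually.of_forall fun z => ?_)
    by_cases h : 1 < ‖z‖
    · simp [hW.eq_zero z h]
    · rw [norm_mul]
      exact mul_le_of_le_one_right (norm_nonneg _) ((PiLp.norm_apply_le z i).trans (not_lt.1 h))
  eq_zero z hz := by simp [hW.eq_zero z hz]

/-- The weighted average `∫ W(z) ψ(x + t z) dz`. -/
noncomputable def avg (W : EuclideanSpace ℝ (Fin d) → ℝ) (ψ : EuclideanSpace ℝ (Fin d) → ℂ)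
    (x : EuclideanSpace ℝ (Fin d)) (t : ℝ) : ℂ :=
  ∫ z, W z • ψ (x + t • z)

/-- The partial derivative of a Schwartz function. -/
noncomputable abbrev pderiv (i : Fin d) (ψ : 𝓢(EuclideanSpace ℝ (Fin d), ℂ)) :
    𝓢(EuclideanSpace ℝ (Fin d), ℂ) :=
  ∂_{EuclideanSpace.single i (1 : ℝ)} ψ

/-- The time derivative of `avg W ψ`. -/
noncomputable def avgDeriv (W : EuclideanSpace ℝ (Fin d) → ℝ)
    (ψ : 𝓢(EuclideanSpace ℝ (Fin d), ℂ)) (x : EuclideanSpace ℝ (Fin d)) (t : ℝ) : ℂ :=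
  ∑ i, avg (fun z => W z * z i) (pderiv i ψ) x t

theorem fderiv_apply_eq_sum (ψ : 𝓢(EuclideanSpace ℝ (Fin d), ℂ))
    (y v : EuclideanSpace ℝ (Fin d)) : fderiv ℝ ψ y v = ∑ i, v i • pderiv i ψ y := by
  have hv : v = ∑ i, v i • EuclideanSpace.single i (1 : ℝ) := by
    ext j
    simp [Pi.single_apply]
  conv_lhs => rw [hv]
  simp [map_sum, SchwartzMap.lineDerivOp_apply_eq_fderiv]

theorem exists_norm_bound (ψ : 𝓢(EuclideanSpace ℝ (Fin d), ℂ)) :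
    ∃ K, ∀ y, ‖ψ y‖ ≤ K := by
  obtain ⟨K, hK⟩ := ψ.decay 0 0
  exact ⟨K, fun y => by simpa using hK.2 y⟩

theorem IsBallWeight.integrable_smul {W : EuclideanSpace ℝ (Fin d) → ℝ} (hW : IsBallWeight W)
    (ψ : 𝓢(EuclideanSpace ℝ (Fin d), ℂ)) (x : EuclideanSpace ℝ (Fin d)) (t : ℝ) :
    Integrable (fun z => W z • ψ (x + t • z)) := by
  obtain ⟨K, hK⟩ := exists_norm_bound ψ
  have hc : Continuous fun z : EuclideanSpace ℝ (Fin d) => ψ (x + t • z) :=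
    ψ.continuous.comp (by fun_prop)
  exact hW.integrable.smul_bdd K hc.aestronglyMeasurable (Eventually.of_forall fun z => hK _)

/-- Chain rule under the integral. As W lives on |z| ≤ 1, the map (x,t) ↦ x + tz has norm at most 2
there, and a constant multiple of |W| dominates. The derivative is written through averages of the
same kind, so that it can be differentiated again. -/
theorem hasFDerivAt_avg {W : EuclideanSpace ℝ (Fin d) → ℝ} (hW : IsBallWeight W)
    (ψ : 𝓢(EuclideanSpace ℝ (Fin d), ℂ)) (p : EuclideanSpace ℝ (Fin d) × ℝ) :
    HasFDerivAt (fun q : EuclideanSpace ℝ (Fin d) × ℝ => avg W ψ q.1 q.2)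
      ((∑ i, ((EuclideanSpace.proj i).comp (ContinuousLinearMap.fst ℝ _ ℝ)).smulRight
          (avg W (pderiv i ψ) p.1 p.2)) +
        (ContinuousLinearMap.snd ℝ _ ℝ).smulRight (avgDeriv W ψ p.1 p.2)) p := by
  let B : (EuclideanSpace ℝ (Fin d)) → ((EuclideanSpace ℝ (Fin d)) × ℝ →L[ℝ] (EuclideanSpace ℝ (Fin d))) := fun z =>
    ContinuousLinearMap.fst ℝ (EuclideanSpace ℝ (Fin d)) ℝ + (ContinuousLinearMap.snd ℝ (EuclideanSpace ℝ (Fin d)) ℝ).smulRight z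
  let F' : (EuclideanSpace ℝ (Fin d)) × ℝ → (EuclideanSpace ℝ (Fin d)) → ((EuclideanSpace ℝ (Fin d)) × ℝ →L[ℝ] ℂ) := fun q z =>
    W z • (fderiv ℝ ψ (q.1 + q.2 • z)).comp (B z)
  obtain ⟨K, hK⟩ : ∃ K, ∀ y, ‖fderiv ℝ ψ y‖ ≤ K := by
    obtain ⟨K, hK⟩ := ψ.decay 0 1
    refine ⟨K, fun y => ?_⟩
    have := hK.2 y
    rwa [pow_zero, one_mul, norm_iteratedFDeriv_one] at this
  have hBc : Continuous B := by
    have : Continuous fun z : (EuclideanSpace ℝ (Fin d)) => (ContinuousLinearMap.snd ℝ (EuclideanSpace ℝ (Fin d)) ℝ).smulRight z :=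
      (ContinuousLinearMap.smulRightL ℝ ((EuclideanSpace ℝ (Fin d)) × ℝ) (EuclideanSpace ℝ (Fin d)) (ContinuousLinearMap.snd ℝ (EuclideanSpace ℝ (Fin d)) ℝ)).continuous
    exact continuous_const.add this
  have hBn : ∀ z, ‖z‖ ≤ 1 → ‖B z‖ ≤ 2 := by
    intro z hz
    refine ContinuousLinearMap.opNorm_le_bound _ (by norm_num) fun q => ?_
    have h1 : ‖q.1‖ ≤ ‖q‖ := norm_fst_le q
    have h2 : ‖q.2‖ ≤ ‖q‖ := norm_snd_le q
    have h3 : ‖q.1 + q.2 • z‖ ≤ ‖q.1‖ + ‖q.2‖ * ‖z‖ := by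
      rw [← norm_smul]; exact norm_add_le _ _
    have h4 : ‖q.2‖ * ‖z‖ ≤ ‖q.2‖ := mul_le_of_le_one_right (norm_nonneg _) hz
    change ‖q.1 + q.2 • z‖ ≤ _
    linarith
  have hK0 : 0 ≤ K := (norm_nonneg _).trans (hK 0)
  have hfc : Continuous (fderiv ℝ ψ) := (ψ.smooth 1).continuous_fderiv one_ne_zero
  have hFb : ∀ q z, ‖F' q z‖ ≤ ‖W z‖ * (K * 2) := by
    intro q z
    by_cases h : 1 < ‖z‖
    · change ‖W z • _‖ ≤ _
      rw [norm_smul, hW.eq_zero z h]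
      simp
    · rw [norm_smul]
      gcongr
      exact (ContinuousLinearMap.opNorm_comp_le _ _).trans
        (mul_le_mul (hK _) (hBn z (not_lt.1 h)) (norm_nonneg _) hK0)
  have hF'm : ∀ q, AEStronglyMeasurable (F' q) volume := fun q =>
    hW.integrable.aestronglyMeasurable.smul
      (Continuous.aestronglyMeasurable ((hfc.comp
        (show Continuous fun z => q.1 + q.2 • z by fun_prop)).clm_comp hBc))
  have hdom : Integrable (fun z => ‖W z‖ * (K * 2)) volume := hW.integrable.norm.mul_const _
  have key := hasFDerivAt_integral_of_dominated_of_fderiv_le (𝕜 := ℝ) (μ := volume)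
    (F := fun (q : (EuclideanSpace ℝ (Fin d)) × ℝ) z => W z • ψ (q.1 + q.2 • z)) (F' := F') (x₀ := p) (s := univ)
    (bound := fun z => ‖W z‖ * (K * 2)) univ_mem
    (Eventually.of_forall fun q => (hW.integrable_smul ψ q.1 q.2).aestronglyMeasurable)
    (hW.integrable_smul ψ p.1 p.2) (hF'm p)
    (Eventually.of_forall fun z q _ => hFb q z) hdom
    (Eventually.of_forall fun z q _ => by
      have h1 : HasFDerivAt (fun q : (EuclideanSpace ℝ (Fin d)) × ℝ => q.1 + q.2 • z) (B z) q :=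
        (B z).hasFDerivAt
      exact ((ψ.differentiable _).hasFDerivAt.comp q h1).const_smul (W z))
  refine key.congr_fderiv ?_
  have hF'i : Integrable (F' p) volume := hdom.mono' (hF'm p) (Eventually.of_forall (hFb p))
  -- Two goals: the derivative on spatial vectors, then on the unit time vector.
  ext q
  · rw [ContinuousLinearMap.comp_apply, ContinuousLinearMap.comp_apply,
      ContinuousLinearMap.integral_apply hF'i]
    have : ∀ z, F' p z (ContinuousLinearMap.inl ℝ (EuclideanSpace ℝ (Fin d)) ℝ q) =
        ∑ i, q i • W z • pderiv i ψ (p.1 + p.2 • z) := by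
      intro z
      simp only [F', B, _root_.smul_apply, ContinuousLinearMap.comp_apply,
        _root_.add_apply, ContinuousLinearMap.coe_fst', ContinuousLinearMap.inl_apply,
        ContinuousLinearMap.smulRight_apply, ContinuousLinearMap.coe_snd', zero_smul, add_zero]
      rw [fderiv_apply_eq_sum, Finset.smul_sum]
      exact Finset.sum_congr rfl fun i _ => smul_comm _ _ _
    simp_rw [this]
    have hi : ∀ i ∈ Finset.univ, Integrable
        (fun z => q i • W z • pderiv i ψ (p.1 + p.2 • z)) volume := fun i _ =>
      (hW.integrable_smul (pderiv i ψ) p.1 p.2).smul (q i)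
    rw [integral_finsetSum _ hi]
    simp only [integral_smul]
    simp [avg]
  · rw [ContinuousLinearMap.comp_apply, ContinuousLinearMap.comp_apply,
      ContinuousLinearMap.integral_apply hF'i]
    have : ∀ z, F' p z (ContinuousLinearMap.inr ℝ (EuclideanSpace ℝ (Fin d)) ℝ 1) =
        ∑ i, (W z * z i) • pderiv i ψ (p.1 + p.2 • z) := by
      intro z
      simp only [F', B, _root_.smul_apply, ContinuousLinearMap.comp_apply,
        _root_.add_apply, ContinuousLinearMap.coe_fst', ContinuousLinearMap.inr_apply,
        ContinuousLinearMap.smulRight_apply, ContinuousLinearMap.coe_snd', one_smul, zero_add]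
      rw [fderiv_apply_eq_sum, Finset.smul_sum]
      exact Finset.sum_congr rfl fun i _ => smul_smul _ _ _
    simp_rw [this]
    rw [integral_finsetSum _ fun i _ =>
      (hW.mul_coord i).integrable_smul (pderiv i ψ) p.1 p.2]
    simp [avg, avgDeriv]

/-- The derivative has averages as coefficients, with weights W and W z_i; hence the induction runs
over all weights and all Schwartz functions at once. -/
theorem contDiff_avg (n : ℕ) {W : EuclideanSpace ℝ (Fin d) → ℝ} (hW : IsBallWeight W)
    (ψ : 𝓢(EuclideanSpace ℝ (Fin d), ℂ)) :
    ContDiff ℝ n (fun q : EuclideanSpace ℝ (Fin d) × ℝ => avg W ψ q.1 q.2) := by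
  induction n generalizing W ψ with
  | zero =>
    exact contDiff_zero.2 (continuous_iff_continuousAt.2 fun p =>
      (hasFDerivAt_avg hW ψ p).continuousAt)
  | succ n ih =>
    rw [Nat.cast_succ]
    refine contDiff_succ_iff_hasFDerivAt.2 ⟨_, ?_, fun p => hasFDerivAt_avg hW ψ p⟩
    unfold avgDeriv
    refine ContDiff.add (ContDiff.sum fun i _ => ContDiff.smulRight contDiff_const (ih hW _))
      (ContDiff.smulRight contDiff_const (ContDiff.sum fun i _ => ih (hW.mul_coord i) _))

theorem hasDerivAt_avg {W : EuclideanSpace ℝ (Fin d) → ℝ} (hW : IsBallWeight W)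
    (ψ : 𝓢(EuclideanSpace ℝ (Fin d), ℂ)) (x : EuclideanSpace ℝ (Fin d)) (t : ℝ) :
    HasDerivAt (fun s => avg W ψ x s) (avgDeriv W ψ x t) t := by
  have h := (hasFDerivAt_avg hW ψ (x, t)).comp_hasDerivAt t
    ((hasDerivAt_const t x).prodMk (hasDerivAt_id t))
  refine h.congr_deriv ?_
  simp

theorem hasDerivAt_avgDeriv {W : EuclideanSpace ℝ (Fin d) → ℝ} (hW : IsBallWeight W)
    (ψ : 𝓢(EuclideanSpace ℝ (Fin d), ℂ)) (x : EuclideanSpace ℝ (Fin d)) (t : ℝ) :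
    HasDerivAt (fun s => avgDeriv W ψ x s)
      (∑ i, avgDeriv (fun z => W z * z i) (pderiv i ψ) x t) t :=
  HasDerivAt.fun_sum fun i _ => hasDerivAt_avg (hW.mul_coord i) (pderiv i ψ) x t

theorem fderiv_avg_single {W : EuclideanSpace ℝ (Fin d) → ℝ} (hW : IsBallWeight W)
    (ψ : 𝓢(EuclideanSpace ℝ (Fin d), ℂ)) (x : EuclideanSpace ℝ (Fin d)) (t : ℝ) (i : Fin d) :
    fderiv ℝ (fun y => avg W ψ y t) x (EuclideanSpace.single i 1) =
      avg W (pderiv i ψ) x t := by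
  have h := (hasFDerivAt_avg hW ψ (x, t)).comp x (f := fun y => (y, t))
    (hasFDerivAt_prodMk_left x t)
  have h' : fderiv ℝ (fun y => avg W ψ y t) x = _ := h.fderiv
  rw [h']
  simp

/-! ### Integrability and mass of the ball weight via the Beta integral -/

/-- The weight `(1 - |z|²)^β` on the open unit ball. -/
noncomputable def ballWeight (d : ℕ) (β : ℝ) (z : EuclideanSpace ℝ (Fin d)) : ℝ :=
  if ‖z‖ < 1 then (1 - ‖z‖ ^ 2) ^ β else 0

/-- The density `s^(a-1) (1-s)^(b-1)` of the Beta integral, extended by zero to `s ≥ 1`. -/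
noncomputable def betaDensity (a b s : ℝ) : ℝ :=
  if s < 1 then s ^ (a - 1) * (1 - s) ^ (b - 1) else 0

/-- The endpoint s = 1 has to be discarded: for b = 1 the complex integrand is 0^0 = 1 there, while
the density is 0. -/
theorem betaDensity_ae_eq (a b : ℝ) :
    betaDensity a b =ᵐ[volume.restrict (Ioi 0)] (Ioc 0 1).indicator
      fun s : ℝ => ((s : ℂ) ^ ((a : ℂ) - 1) * (1 - (s : ℂ)) ^ ((b : ℂ) - 1)).re := by
  have h1 : ∀ᵐ s : ℝ ∂volume.restrict (Ioi 0), s ≠ 1 :=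
    ae_restrict_of_ae (Measure.ae_ne volume 1)
  filter_upwards [h1, ae_restrict_mem measurableSet_Ioi] with s hs1 hs
  have hs0 : 0 < s := hs
  unfold betaDensity
  by_cases h : s < 1
  · rw [if_pos h, indicator_of_mem (show s ∈ Ioc (0 : ℝ) 1 from ⟨hs0, h.le⟩)]
    have e1 : (s : ℂ) ^ ((a : ℂ) - 1) = ((s ^ (a - 1) : ℝ) : ℂ) := by
      rw [Complex.ofReal_cpow hs0.le]; push_cast; rfl
    have e2 : (1 - (s : ℂ)) ^ ((b : ℂ) - 1) = (((1 - s) ^ (b - 1) : ℝ) : ℂ) := by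
      rw [Complex.ofReal_cpow (by linarith)]; push_cast; rfl
    rw [e1, e2, ← Complex.ofReal_mul, Complex.ofReal_re]
  · rw [if_neg h, indicator_of_notMem]
    rintro ⟨_, h'⟩
    exact hs1 (le_antisymm h' (not_lt.1 h))

theorem integrableOn_betaDensity {a b : ℝ} (ha : 0 < a) (hb : 0 < b) :
    IntegrableOn (betaDensity a b) (Ioi 0) := by
  have h := Complex.betaIntegral_convergent (u := a) (v := b) (by simpa) (by simpa)
  rw [intervalIntegrable_iff_integrableOn_Ioc_of_le zero_le_one] at h
  refine Integrable.congr ?_ (betaDensity_ae_eq a b).symm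
  exact ((integrable_indicator_iff measurableSet_Ioc).2 h.re).mono_measure Measure.restrict_le_self

theorem integral_betaDensity {a b : ℝ} (ha : 0 < a) (hb : 0 < b) :
    ∫ s in Ioi 0, betaDensity a b s = ProbabilityTheory.beta a b := by
  have h := Complex.betaIntegral_convergent (u := a) (v := b) (by simpa) (by simpa)
  rw [intervalIntegrable_iff_integrableOn_Ioc_of_le zero_le_one] at h
  rw [integral_congr_ae (betaDensity_ae_eq a b), setIntegral_indicator measurableSet_Ioc,
    inter_eq_right.2 Ioc_subset_Ioi_self, ProbabilityTheory.beta_eq_betaIntegralReal a b ha hb,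
    Complex.betaIntegral, intervalIntegral.integral_of_le zero_le_one]
  exact integral_re h

/-- Prepares the substitution s = r² in polar coordinates: r^(d-1) = r (r²)^(d/2-1), where the
factor r is, up to 2, the Jacobian. -/
theorem pow_smul_radial_eq (hd : 0 < d) (β : ℝ) {r : ℝ} (hr : 0 < r) :
    r ^ (d - 1) • (if r < 1 then (1 - r ^ 2) ^ β else 0) =
      r ^ ((2 : ℝ) - 1) • betaDensity (d / 2) (β + 1) (r ^ (2 : ℝ)) := by
  have hlt : r ^ 2 < 1 ↔ r < 1 := by rw [sq_lt_one_iff₀ hr.le]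
  rw [Real.rpow_two, betaDensity]
  by_cases h : r < 1
  · rw [if_pos h, if_pos (hlt.2 h), smul_eq_mul, smul_eq_mul, add_sub_cancel_right, ← mul_assoc]
    congr 1
    rw [← Real.rpow_natCast, ← Real.rpow_natCast r 2, ← Real.rpow_mul hr.le, ← Real.rpow_add hr]
    congr 1
    rw [Nat.cast_sub hd]
    push_cast
    ring
  · rw [if_neg h, if_neg (mt hlt.1 h), smul_zero, smul_zero]

theorem isBallWeight_ballWeight (hd : 0 < d) {β : ℝ} (hβ : -1 < β) :
    IsBallWeight (ballWeight d β) where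
  integrable := by
    have : Nonempty (Fin d) := ⟨⟨0, hd⟩⟩
    refine (integrable_fun_norm_addHaar (volume : Measure (EuclideanSpace ℝ (Fin d)))
      (f := fun r : ℝ => if r < 1 then (1 - r ^ 2) ^ β else 0)).2 ?_
    have e : EqOn (fun r : ℝ => r ^ (d - 1) • (if r < 1 then (1 - r ^ 2) ^ β else 0))
        (fun r => r ^ ((2 : ℝ) - 1) • betaDensity (d / 2) (β + 1) (r ^ (2 : ℝ))) (Ioi 0) :=
      fun r hr => pow_smul_radial_eq hd β hr
    rw [finrank_euclideanSpace_fin, integrableOn_congr_fun e measurableSet_Ioi]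
    exact (integrableOn_Ioi_comp_rpow_iff' _ two_ne_zero).2
      (integrableOn_betaDensity (by positivity) (by linarith))
  eq_zero z hz := if_neg hz.le.not_gt

theorem integral_ballWeight (hd : 0 < d) {β : ℝ} (hβ : -1 < β) :
    ∫ z, ballWeight d β z =
      Real.pi ^ ((d : ℝ) / 2) * Real.Gamma (β + 1) / Real.Gamma ((d : ℝ) / 2 + β + 1) := by
  have : Nonempty (Fin d) := ⟨⟨0, hd⟩⟩
  have hd' : (0 : ℝ) < d / 2 := by positivity
  have h := integral_fun_norm_addHaar (volume : Measure (EuclideanSpace ℝ (Fin d)))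
      (fun r : ℝ => if r < 1 then (1 - r ^ 2) ^ β else 0)
  have h2 := integral_comp_rpow_Ioi_of_pos (g := betaDensity (d / 2) (β + 1)) (p := 2) two_pos
  have hv : (volume : Measure (EuclideanSpace ℝ (Fin d))).real (Metric.ball 0 1) =
      Real.pi ^ ((d : ℝ) / 2) / (d / 2 * Real.Gamma (d / 2)) := by
    rw [Measure.real, EuclideanSpace.volume_ball, ENNReal.ofReal_one, one_pow, one_mul,
      ENNReal.toReal_ofReal (by positivity), Fintype.card_fin, Real.Gamma_add_one hd'.ne',
      Real.sqrt_eq_rpow, ← Real.rpow_mul_natCast Real.pi_pos.le]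
    congr 2
    ring
  simp_rw [mul_smul] at h2
  rw [integral_smul, integral_betaDensity hd' (by linarith)] at h2
  rw [finrank_euclideanSpace_fin, setIntegral_congr_fun measurableSet_Ioi
    (fun r hr => pow_smul_radial_eq hd β hr), hv] at h
  refine h.trans ?_
  have h3 : ∫ r in Ioi (0 : ℝ), r ^ ((2 : ℝ) - 1) • betaDensity (d / 2) (β + 1) (r ^ (2 : ℝ)) =
      ProbabilityTheory.beta (d / 2) (β + 1) / 2 := by
    rw [← h2, smul_eq_mul]; ring
  have hG : Real.Gamma ((d : ℝ) / 2) ≠ 0 := (Real.Gamma_pos_of_pos hd').ne'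
  have hd0 : (d : ℝ) ≠ 0 := by positivity
  rw [h3, ProbabilityTheory.beta, nsmul_eq_mul, smul_eq_mul, ← add_assoc]
  field_simp

/-! ### A C¹ regularisation of the positive part of s to the power β -/

theorem hasDerivAt_max_zero_sq (s : ℝ) :
    HasDerivAt (fun s : ℝ => (max s 0) ^ 2) (2 * max s 0) s := by
  rcases lt_trichotomy s 0 with h | rfl | h
  · rw [max_eq_right h.le, mul_zero]
    refine (hasDerivAt_const s (0 : ℝ)).congr_of_eventuallyEq ?_
    filter_upwards [gt_mem_nhds h] with r hr
    simp [max_eq_right (le_of_lt hr)]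
  · rw [max_self, mul_zero, hasDerivAt_iff_isLittleO]
    have : (fun x' : ℝ => (max x' 0) ^ 2 - (max (0 : ℝ) 0) ^ 2 - (x' - 0) • (0 : ℝ))
        =O[𝓝 0] fun x' => ‖x' - 0‖ ^ 2 := by
      refine Asymptotics.IsBigO.of_bound 1 (Eventually.of_forall fun x => ?_)
      have hx : |max x 0| ≤ |x| := by
        rcases le_total x 0 with hx | hx
        · rw [max_eq_right hx, abs_zero]; exact abs_nonneg x
        · rw [max_eq_left hx]
      simpa using sq_le_sq.2 hx
    exact this.trans_isLittleO (Asymptotics.isLittleO_pow_sub_sub (0 : ℝ) one_lt_two)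
  · rw [max_eq_left h.le]
    have := hasDerivAt_pow 2 s
    simp only [Nat.cast_ofNat, Nat.add_one_sub_one, pow_one] at this
    refine this.congr_of_eventuallyEq ?_
    filter_upwards [lt_mem_nhds h] with r hr
    rw [max_eq_left (le_of_lt hr)]

/-- A `C¹` approximation of `s ↦ s₊ ^ β`, vanishing for `s ≤ 0`. -/
noncomputable def approxPow (β ε s : ℝ) : ℝ := (max s 0 ^ 2 + ε) ^ (β / 2) - ε ^ (β / 2)

/-- The derivative of `approxPow`. -/
noncomputable def approxPowDeriv (β ε s : ℝ) : ℝ :=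
  β * max s 0 * (max s 0 ^ 2 + ε) ^ (β / 2 - 1)

theorem hasDerivAt_approxPow (β : ℝ) {ε : ℝ} (hε : 0 < ε) (s : ℝ) :
    HasDerivAt (approxPow β ε) (approxPowDeriv β ε s) s := by
  have h := (((hasDerivAt_max_zero_sq s).add_const ε).rpow_const (p := β / 2)
    (Or.inl (by positivity))).sub_const (ε ^ (β / 2))
  refine h.congr_deriv ?_
  unfold approxPowDeriv
  ring

theorem continuous_approxPowDeriv (β : ℝ) {ε : ℝ} (hε : 0 < ε) :
    Continuous (approxPowDeriv β ε) := by
  unfold approxPowDeriv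
  refine Continuous.mul (by fun_prop) (Continuous.rpow_const (by fun_prop) fun s => Or.inl ?_)
  positivity

theorem approxPow_of_nonpos (β ε : ℝ) {s : ℝ} (hs : s ≤ 0) : approxPow β ε s = 0 := by
  simp [approxPow, max_eq_right hs]

theorem approxPowDeriv_of_nonpos (β ε : ℝ) {s : ℝ} (hs : s ≤ 0) : approxPowDeriv β ε s = 0 := by
  simp [approxPowDeriv, max_eq_right hs]

theorem tendsto_approxPow {β : ℝ} (hβ : 0 < β) {s : ℝ} (hs : 0 < s) :
    Tendsto (fun ε => approxPow β ε s) (𝓝[>] 0) (𝓝 (s ^ β)) := by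
  have hc : ContinuousAt (fun ε => approxPow β ε s) 0 := by
    unfold approxPow
    refine ContinuousAt.sub (ContinuousAt.rpow_const (by fun_prop) (Or.inr (by positivity)))
      (ContinuousAt.rpow_const (by fun_prop) (Or.inr (by positivity)))
  have h := hc.tendsto.mono_left (nhdsWithin_le_nhds (s := Ioi 0))
  have e : approxPow β 0 s = s ^ β := by
    rw [approxPow, max_eq_left hs.le, add_zero, Real.zero_rpow (by positivity), sub_zero,
      ← Real.rpow_natCast_mul hs.le]
    congr 1
    push_cast
    ring
  rwa [e] at h

theorem tendsto_approxPowDeriv (β : ℝ) {s : ℝ} (hs : 0 < s) :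
    Tendsto (fun ε => approxPowDeriv β ε s) (𝓝[>] 0) (𝓝 (β * s ^ (β - 1))) := by
  have hc : ContinuousAt (fun ε => approxPowDeriv β ε s) 0 := by
    unfold approxPowDeriv
    refine ContinuousAt.mul (by fun_prop) (ContinuousAt.rpow_const (by fun_prop) (Or.inl ?_))
    rw [max_eq_left hs.le]
    positivity
  have h := hc.tendsto.mono_left (nhdsWithin_le_nhds (s := Ioi 0))
  have e : approxPowDeriv β 0 s = β * s ^ (β - 1) := by
    rw [approxPowDeriv, max_eq_left hs.le, add_zero, ← Real.rpow_natCast_mul hs.le, mul_assoc]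
    congr 1
    nth_rewrite 1 [← Real.rpow_one s]
    rw [← Real.rpow_add hs]
    congr 1
    push_cast
    ring
  rwa [e] at h

theorem abs_approxPow_le {β : ℝ} (hβ : 0 < β) {ε s : ℝ} (hε : 0 < ε) (hε1 : ε < 1)
    (hs : s ≤ 1) : |approxPow β ε s| ≤ 2 ^ (β / 2) := by
  have h0 : 0 ≤ max s 0 := le_max_right _ _
  have h1 : max s 0 ≤ 1 := max_le hs zero_le_one
  have h2 : ε ^ (β / 2) ≤ (max s 0 ^ 2 + ε) ^ (β / 2) := by gcongr; nlinarith
  have h3 : (max s 0 ^ 2 + ε) ^ (β / 2) ≤ 2 ^ (β / 2) := by gcongr; nlinarith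
  have h4 : 0 ≤ ε ^ (β / 2) := by positivity
  unfold approxPow
  rw [abs_of_nonneg (by linarith)]
  linarith

/-- The exponent β/2 - 1 is negative, so adding ε only decreases the power: the limit itself
dominates the approximations. -/
theorem abs_approxPowDeriv_le {β : ℝ} (hβ : 0 < β) (hβ1 : β < 1) {ε s : ℝ} (hε : 0 < ε)
    (hs : 0 < s) : |approxPowDeriv β ε s| ≤ β * s ^ (β - 1) := by
  rw [approxPowDeriv, max_eq_left hs.le, abs_of_nonneg (by positivity), mul_assoc]
  gcongr
  have h : (s ^ 2 + ε) ^ (β / 2 - 1) ≤ (s ^ 2) ^ (β / 2 - 1) :=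
    Real.rpow_le_rpow_of_nonpos (by positivity) (by linarith) (by linarith)
  have e : s * (s ^ 2) ^ (β / 2 - 1) = s ^ (β - 1) := by
    rw [← Real.rpow_natCast_mul hs.le]
    nth_rewrite 1 [← Real.rpow_one s]
    rw [← Real.rpow_add hs]
    congr 1
    push_cast
    ring
  rw [← e]
  gcongr

/-! ### Integration by parts against the ball weight -/

theorem one_sub_norm_sq_pos_iff {z : EuclideanSpace ℝ (Fin d)} : 0 < 1 - ‖z‖ ^ 2 ↔ ‖z‖ < 1 := by
  rw [sub_pos, sq_lt_one_iff₀ (norm_nonneg z)]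

theorem hasFDerivAt_approxPow_norm (β : ℝ) {ε : ℝ} (hε : 0 < ε) (z : EuclideanSpace ℝ (Fin d)) :
    HasFDerivAt (fun z : EuclideanSpace ℝ (Fin d) => approxPow β ε (1 - ‖z‖ ^ 2))
      (approxPowDeriv β ε (1 - ‖z‖ ^ 2) •
        (-(2 • innerSL ℝ z) : EuclideanSpace ℝ (Fin d) →L[ℝ] ℝ)) z :=
  (hasDerivAt_approxPow β hε _).comp_hasFDerivAt z
    ((hasStrictFDerivAt_norm_sq z).hasFDerivAt.const_sub 1)

theorem integral_approxPow_smul_fderiv (β : ℝ) {ε : ℝ} (hε : 0 < ε)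
    {H : EuclideanSpace ℝ (Fin d) → ℂ} (hH : ContDiff ℝ 1 H) (i : Fin d) :
    ∫ z, approxPow β ε (1 - ‖z‖ ^ 2) • fderiv ℝ H z (EuclideanSpace.single i 1) =
      2 * ∫ z, (approxPowDeriv β ε (1 - ‖z‖ ^ 2) * z i) • H z := by
  have hf : ∀ z : EuclideanSpace ℝ (Fin d),
      fderiv ℝ (fun z : EuclideanSpace ℝ (Fin d) => approxPow β ε (1 - ‖z‖ ^ 2)) z
        (EuclideanSpace.single i 1) = -2 * (approxPowDeriv β ε (1 - ‖z‖ ^ 2) * z i) := by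
    intro z
    rw [(hasFDerivAt_approxPow_norm β hε z).fderiv]
    simp [EuclideanSpace.inner_single_right]
    ring
  have hout : ∀ z : EuclideanSpace ℝ (Fin d), z ∉ Metric.closedBall 0 1 → 1 - ‖z‖ ^ 2 ≤ 0 := by
    intro z hz
    rw [mem_closedBall_zero_iff, not_le] at hz
    nlinarith
  have hK := isCompact_closedBall (0 : EuclideanSpace ℝ (Fin d)) 1
  have hc1 : Continuous fun z : EuclideanSpace ℝ (Fin d) => approxPow β ε (1 - ‖z‖ ^ 2) :=
    continuous_iff_continuousAt.2 fun z => (hasFDerivAt_approxPow_norm β hε z).continuousAt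
  have hc2 : Continuous fun z : EuclideanSpace ℝ (Fin d) =>
      -2 * (approxPowDeriv β ε (1 - ‖z‖ ^ 2) * z i) := by
    have := (continuous_approxPowDeriv β hε).comp
      (show Continuous fun z : EuclideanSpace ℝ (Fin d) => 1 - ‖z‖ ^ 2 by fun_prop)
    exact continuous_const.mul (this.mul (by fun_prop))
  have hc3 : Continuous fun z => fderiv ℝ H z (EuclideanSpace.single i 1) :=
    (hH.continuous_fderiv one_ne_zero).clm_apply continuous_const
  rw [integral_smul_fderiv_eq_neg_fderiv_smul_of_integrable]
  · simp_rw [hf, mul_smul]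
    rw [integral_smul]
    simp
  · simp_rw [hf]
    exact (hc2.smul hH.continuous).integrable_of_hasCompactSupport
      (HasCompactSupport.intro hK fun z hz => by
        simp [approxPowDeriv_of_nonpos β ε (hout z hz)])
  · exact (hc1.smul hc3).integrable_of_hasCompactSupport
      (HasCompactSupport.intro hK fun z hz => by simp [approxPow_of_nonpos β ε (hout z hz)])
  · exact (hc1.smul hH.continuous).integrable_of_hasCompactSupport
      (HasCompactSupport.intro hK fun z hz => by simp [approxPow_of_nonpos β ε (hout z hz)])
  · exact fun z _ => (hasFDerivAt_approxPow_norm β hε z).differentiableAt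
  · exact fun z _ => hH.differentiable one_ne_zero z

/-- This is ∇w_β = -2β z w_(β-1) in integrated form. The boundary term vanishes because β > 0, but
the gradient blows up at the sphere; so the identity is proved for the regularised weight and ε → 0
by dominated convergence. -/
theorem integral_ballWeight_smul_fderiv (hd : 0 < d) {β : ℝ} (hβ : 0 < β) (hβ1 : β < 1)
    {H : EuclideanSpace ℝ (Fin d) → ℂ} (hH : ContDiff ℝ 1 H) (i : Fin d) :
    ∫ z, ballWeight d β z • fderiv ℝ H z (EuclideanSpace.single i 1) =
      2 * β * ∫ z, (ballWeight d (β - 1) z * z i) • H z := by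
  have hK := isCompact_closedBall (0 : EuclideanSpace ℝ (Fin d)) 1
  have hc3 : Continuous fun z => fderiv ℝ H z (EuclideanSpace.single i 1) :=
    (hH.continuous_fderiv one_ne_zero).clm_apply continuous_const
  obtain ⟨M, hM⟩ := hK.exists_bound_of_continuousOn hH.continuous.continuousOn
  obtain ⟨M', hM'⟩ := hK.exists_bound_of_continuousOn hc3.continuousOn
  have hw := isBallWeight_ballWeight hd (show -1 < β - 1 by linarith)
  have hsmall : ∀ᶠ ε in 𝓝[>] (0 : ℝ), 0 < ε ∧ ε < 1 :=
    Ioo_mem_nhdsGT zero_lt_one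
  have hin : ∀ z : EuclideanSpace ℝ (Fin d), ‖z‖ < 1 → z ∈ Metric.closedBall 0 1 := fun z hz => by
    rw [mem_closedBall_zero_iff]; exact hz.le
  have hnp : ∀ z : EuclideanSpace ℝ (Fin d), ¬ ‖z‖ < 1 → 1 - ‖z‖ ^ 2 ≤ 0 := fun z hz =>
    not_lt.1 fun h => hz (one_sub_norm_sq_pos_iff.1 h)
  have L1 : Tendsto (fun ε => ∫ z : EuclideanSpace ℝ (Fin d),
      approxPow β ε (1 - ‖z‖ ^ 2) • fderiv ℝ H z (EuclideanSpace.single i 1)) (𝓝[>] 0)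
      (𝓝 (∫ z, ballWeight d β z • fderiv ℝ H z (EuclideanSpace.single i 1))) := by
    refine tendsto_integral_filter_of_dominated_convergence
      ((Metric.ball 0 1).indicator fun _ => (2 : ℝ) ^ (β / 2) * M') ?_ ?_ ?_ ?_
    · filter_upwards [hsmall] with ε hε
      have hc1 : Continuous fun z : EuclideanSpace ℝ (Fin d) => approxPow β ε (1 - ‖z‖ ^ 2) :=
        continuous_iff_continuousAt.2 fun z => (hasFDerivAt_approxPow_norm β hε.1 z).continuousAt
      exact (hc1.smul hc3).aestronglyMeasurable
    · filter_upwards [hsmall] with ε hε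
      refine Eventually.of_forall fun z => ?_
      by_cases hz : ‖z‖ < 1
      · rw [indicator_of_mem (by simpa using hz), norm_smul]
        gcongr
        · exact abs_approxPow_le hβ hε.1 hε.2 (by nlinarith [norm_nonneg z])
        · exact hM' z (hin z hz)
      · rw [indicator_of_notMem (by simpa using hz), approxPow_of_nonpos β ε (hnp z hz)]
        simp
    · exact (integrable_indicator_iff measurableSet_ball).2
        (integrableOn_const measure_ball_lt_top.ne)
    · refine Eventually.of_forall fun z => ?_
      by_cases hz : ‖z‖ < 1
      · rw [ballWeight, if_pos hz]
        exact (tendsto_approxPow hβ (one_sub_norm_sq_pos_iff.2 hz)).smul_const _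
      · simp_rw [approxPow_of_nonpos β _ (hnp z hz)]
        rw [ballWeight, if_neg hz]
        exact tendsto_const_nhds
  have L2 : Tendsto (fun ε => ∫ z : EuclideanSpace ℝ (Fin d),
      (approxPowDeriv β ε (1 - ‖z‖ ^ 2) * z i) • H z) (𝓝[>] 0)
      (𝓝 (∫ z, (β * (ballWeight d (β - 1) z * z i)) • H z)) := by
    -- The majorant is a multiple of w_(β-1), integrable because β - 1 > -1.
    refine tendsto_integral_filter_of_dominated_convergence
      (fun z => ballWeight d (β - 1) z * (β * 1 * M)) ?_ ?_ ?_ ?_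
    · filter_upwards [hsmall] with ε hε
      have hc1 := (continuous_approxPowDeriv β hε.1).comp
        (show Continuous fun z : EuclideanSpace ℝ (Fin d) => 1 - ‖z‖ ^ 2 by fun_prop)
      exact ((hc1.mul (by fun_prop)).smul hH.continuous).aestronglyMeasurable
    · filter_upwards [hsmall] with ε hε
      refine Eventually.of_forall fun z => ?_
      by_cases hz : ‖z‖ < 1
      · have h1 := abs_approxPowDeriv_le hβ hβ1 hε.1 (one_sub_norm_sq_pos_iff.2 hz)
        have h2 : ‖z i‖ ≤ 1 := (PiLp.norm_apply_le z i).trans hz.le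
        have h0 : 0 < 1 - ‖z‖ ^ 2 := one_sub_norm_sq_pos_iff.2 hz
        rw [ballWeight, if_pos hz, norm_smul, norm_mul]
        calc _ ≤ (β * (1 - ‖z‖ ^ 2) ^ (β - 1)) * 1 * M := by
              gcongr
              · exact h1
              · exact hM z (hin z hz)
          _ = _ := by ring
      · rw [ballWeight, if_neg hz, approxPowDeriv_of_nonpos β ε (hnp z hz)]
        simp
    · exact hw.integrable.mul_const _
    · refine Eventually.of_forall fun z => ?_
      by_cases hz : ‖z‖ < 1
      · rw [ballWeight, if_pos hz, ← mul_assoc]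
        exact ((tendsto_approxPowDeriv β (one_sub_norm_sq_pos_iff.2 hz)).mul_const _).smul_const _
      · simp_rw [approxPowDeriv_of_nonpos β _ (hnp z hz)]
        rw [ballWeight, if_neg hz]
        simp
  have L3 := L2.const_mul (2 : ℂ)
  have heq := tendsto_nhds_unique (L1.congr' (by
    filter_upwards [hsmall] with ε hε
    exact integral_approxPow_smul_fderiv β hε.1 hH i)) L3
  rw [heq]
  simp_rw [mul_smul β]
  rw [integral_smul, Complex.real_smul]
  ring

/-! ### Identities linking the averages with exponents β and β - 1 -/

theorem avg_sum {ι : Type*} {W : EuclideanSpace ℝ (Fin d) → ℝ} (hW : IsBallWeight W)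
    (s : Finset ι) (ψ : ι → 𝓢(EuclideanSpace ℝ (Fin d), ℂ)) (x : EuclideanSpace ℝ (Fin d))
    (t : ℝ) : avg W (∑ i ∈ s, ψ i : 𝓢(EuclideanSpace ℝ (Fin d), ℂ)) x t = ∑ i ∈ s, avg W (ψ i) x t := by
  unfold avg
  rw [← integral_finsetSum _ fun i _ => hW.integrable_smul (ψ i) x t]
  simp [Finset.smul_sum, _root_.sum_apply]

theorem laplacian_eq_sum_pderiv (ψ : 𝓢(EuclideanSpace ℝ (Fin d), ℂ)) :
    Laplacian.laplacian ψ = ∑ i, pderiv i (pderiv i ψ) := by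
  rw [SchwartzMap.laplacian_eq_sum (EuclideanSpace.basisFun (Fin d) ℝ)]
  simp

theorem hasFDerivAt_comp_affine (ψ : 𝓢(EuclideanSpace ℝ (Fin d), ℂ))
    (x : EuclideanSpace ℝ (Fin d)) (t : ℝ) (z : EuclideanSpace ℝ (Fin d)) :
    HasFDerivAt (fun z => ψ (x + t • z)) (t • fderiv ℝ ψ (x + t • z)) z := by
  have h := (ψ.hasFDerivAt (x + t • z)).comp z
    (((hasFDerivAt_id z).const_smul t).const_add x)
  refine h.congr_fderiv ?_
  ext v
  simp

theorem contDiff_comp_affine (ψ : 𝓢(EuclideanSpace ℝ (Fin d), ℂ))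
    (x : EuclideanSpace ℝ (Fin d)) (t : ℝ) : ContDiff ℝ 1 (fun z => ψ (x + t • z)) :=
  (ψ.smooth 1).comp (by fun_prop)

/-- The factor t comes from ∂_(z_i) [ψ(x + tz)] = t (∂_i ψ)(x + tz); the rest is integration by
parts. -/
theorem mul_avg_pderiv (hd : 0 < d) {β : ℝ} (hβ : 0 < β) (hβ1 : β < 1)
    (ψ : 𝓢(EuclideanSpace ℝ (Fin d), ℂ)) (x : EuclideanSpace ℝ (Fin d)) (t : ℝ) (i : Fin d) :
    t * avg (ballWeight d β) (pderiv i ψ) x t =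
      2 * β * avg (fun z => ballWeight d (β - 1) z * z i) ψ x t := by
  have h := integral_ballWeight_smul_fderiv hd hβ hβ1 (contDiff_comp_affine ψ x t) i
  unfold avg
  rw [← h, ← Complex.real_smul, ← integral_smul]
  refine integral_congr_ae (Eventually.of_forall fun z => ?_)
  simp only [(hasFDerivAt_comp_affine ψ x t z).fderiv, _root_.smul_apply,
    SchwartzMap.lineDerivOp_apply_eq_fderiv]
  exact smul_comm _ _ _

theorem mul_avg_laplacian (hd : 0 < d) {β : ℝ} (hβ : 0 < β) (hβ1 : β < 1)
    (ψ : 𝓢(EuclideanSpace ℝ (Fin d), ℂ)) (x : EuclideanSpace ℝ (Fin d)) (t : ℝ) :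
    t * avg (ballWeight d β) (Laplacian.laplacian ψ : 𝓢(EuclideanSpace ℝ (Fin d), ℂ)) x t =
      2 * β * avgDeriv (ballWeight d (β - 1)) ψ x t := by
  rw [laplacian_eq_sum_pderiv,
    avg_sum (isBallWeight_ballWeight hd (by linarith)), avgDeriv, Finset.mul_sum, Finset.mul_sum]
  exact Finset.sum_congr rfl fun i _ => mul_avg_pderiv hd hβ hβ1 _ x t i

theorem ballWeight_sub_one (d : ℕ) (β : ℝ) (z : EuclideanSpace ℝ (Fin d)) :
    ballWeight d (β - 1) z = ballWeight d β z + ∑ i, ballWeight d (β - 1) z * z i * z i := by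
  have hn : ‖z‖ ^ 2 = ∑ i, z i * z i := by
    rw [EuclideanSpace.real_norm_sq_eq]
    exact Finset.sum_congr rfl fun i _ => sq _
  simp_rw [mul_assoc]
  rw [← Finset.mul_sum, ← hn]
  unfold ballWeight
  split_ifs with h
  · have h0 := one_sub_norm_sq_pos_iff.2 h
    rw [Real.rpow_sub_one h0.ne']
    field_simp
    ring
  · simp

/-- Integrating by parts with the field z ψ(x + tz), whose divergence is d ψ + t z·∇ψ, produces the
weight 2β |z|² w_(β-1), and |z|² w_(β-1) = w_(β-1) - w_β. -/
theorem avg_ballWeight_sub_one (hd : 0 < d) {β : ℝ} (hβ : 0 < β) (hβ1 : β < 1)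
    (ψ : 𝓢(EuclideanSpace ℝ (Fin d), ℂ)) (x : EuclideanSpace ℝ (Fin d)) (t : ℝ) :
    2 * β * avg (ballWeight d (β - 1)) ψ x t =
      (d + 2 * β) * avg (ballWeight d β) ψ x t + t * avgDeriv (ballWeight d β) ψ x t := by
  have hw := isBallWeight_ballWeight hd (show -1 < β by linarith)
  have hw' := isBallWeight_ballWeight hd (show -1 < β - 1 by linarith)
  have h1 : ∀ i, avg (ballWeight d β) ψ x t +
      t * avg (fun z => ballWeight d β z * z i) (pderiv i ψ) x t =
      2 * β * avg (fun z => ballWeight d (β - 1) z * z i * z i) ψ x t := by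
    intro i
    -- The i-th component of the field z ψ(x + tz); summing over i recovers the divergence.
    have hc : ContDiff ℝ 1 fun z : EuclideanSpace ℝ (Fin d) => z i • ψ (x + t • z) :=
      ContDiff.smul (show ContDiff ℝ 1 fun z : EuclideanSpace ℝ (Fin d) => z i by fun_prop)
        (contDiff_comp_affine ψ x t)
    have h := integral_ballWeight_smul_fderiv hd hβ hβ1 hc i
    have e1 : ∀ z : EuclideanSpace ℝ (Fin d),
        fderiv ℝ (fun z : EuclideanSpace ℝ (Fin d) => z i • ψ (x + t • z)) z
          (EuclideanSpace.single i 1) = ψ (x + t • z) + t • z i • pderiv i ψ (x + t • z) := by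
      intro z
      have hp : HasFDerivAt (fun z : EuclideanSpace ℝ (Fin d) => z i)
          (EuclideanSpace.proj i : EuclideanSpace ℝ (Fin d) →L[ℝ] ℝ) z :=
        (EuclideanSpace.proj i : EuclideanSpace ℝ (Fin d) →L[ℝ] ℝ).hasFDerivAt
      rw [(hp.fun_smul (hasFDerivAt_comp_affine ψ x t z)).fderiv]
      simp [SchwartzMap.lineDerivOp_apply_eq_fderiv]
      ring
    simp_rw [e1, smul_add] at h
    have hi2 : Integrable fun z : EuclideanSpace ℝ (Fin d) =>
        t • (ballWeight d β z * z i) • pderiv i ψ (x + t • z) :=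
      ((hw.mul_coord i).integrable_smul (pderiv i ψ) x t).smul t
    have e2 : ∀ z : EuclideanSpace ℝ (Fin d),
        ballWeight d β z • t • z i • pderiv i ψ (x + t • z) =
          t • (ballWeight d β z * z i) • pderiv i ψ (x + t • z) := by
      intro z
      rw [smul_comm, smul_smul (ballWeight d β z)]
    simp_rw [e2] at h
    rw [integral_add (hw.integrable_smul ψ x t) hi2, integral_smul, Complex.real_smul] at h
    unfold avg
    rw [h]
    simp_rw [mul_smul]
  have h2 : avg (ballWeight d (β - 1)) ψ x t = avg (ballWeight d β) ψ x t +
      ∑ i, avg (fun z => ballWeight d (β - 1) z * z i * z i) ψ x t := by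
    unfold avg
    rw [← integral_finsetSum _ fun i _ =>
        ((hw'.mul_coord i).mul_coord i).integrable_smul ψ x t,
      ← integral_add (hw.integrable_smul ψ x t) (integrable_finsetSum _ fun i _ =>
        ((hw'.mul_coord i).mul_coord i).integrable_smul ψ x t)]
    refine integral_congr_ae (Eventually.of_forall fun z => ?_)
    simp only
    conv_lhs => rw [ballWeight_sub_one, add_smul, Finset.sum_smul]
  have h3 := Finset.sum_congr (rfl : (Finset.univ : Finset (Fin d)) = Finset.univ)
    fun i _ => h1 i
  rw [Finset.sum_add_distrib, ← Finset.mul_sum, ← Finset.mul_sum, Finset.sum_const,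
    Finset.card_univ, Fintype.card_fin, nsmul_eq_mul] at h3
  rw [h2, mul_add, ← h3, avgDeriv]
  ring

/-! ### The profile: time derivative, smoothness, Laplacian -/

/-- The combination `(2σ+2) avg W ψ + t ∂_t avg W ψ`. -/
noncomputable def profile (W : EuclideanSpace ℝ (Fin d) → ℝ) (σ : ℝ)
    (ψ : 𝓢(EuclideanSpace ℝ (Fin d), ℂ)) (x : EuclideanSpace ℝ (Fin d)) (t : ℝ) : ℂ :=
  (2 * σ + 2) * avg W ψ x t + t * avgDeriv W ψ x t

/-- Trading t ∂_t A_ψ for t² B_(Δψ)/(2β) avoids a second time derivative of A_ψ. Differentiating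
then leaves t/(2β) times (2σ+4) B_(Δψ) + t ∂_t B_(Δψ), and 2σ + 4 = d + 2β makes this t A_(Δψ). -/
theorem hasDerivAt_profile (hd : 0 < d) {σ β : ℝ} (hβ : 0 < β) (hβ1 : β < 1)
    (hσβ : d + 2 * β = 2 * σ + 4) (ψ : 𝓢(EuclideanSpace ℝ (Fin d), ℂ))
    (x : EuclideanSpace ℝ (Fin d)) (t : ℝ) :
    HasDerivAt (fun s => profile (ballWeight d (β - 1)) σ ψ x s)
      (t * avg (ballWeight d (β - 1))
        (Laplacian.laplacian ψ : 𝓢(EuclideanSpace ℝ (Fin d), ℂ)) x t) t := by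
  have hw := isBallWeight_ballWeight hd (show -1 < β by linarith)
  have hw' := isBallWeight_ballWeight hd (show -1 < β - 1 by linarith)
  have hβ0 : (β : ℂ) ≠ 0 := by exact_mod_cast hβ.ne'
  set ψ₂ : 𝓢(EuclideanSpace ℝ (Fin d), ℂ) := Laplacian.laplacian ψ with hψ₂
  have e : ∀ s, profile (ballWeight d (β - 1)) σ ψ x s =
      (2 * σ + 2) * avg (ballWeight d (β - 1)) ψ x s +
        s ^ 2 * avg (ballWeight d β) ψ₂ x s / (2 * β) := by
    intro s
    have h := mul_avg_laplacian hd hβ hβ1 ψ x s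
    rw [← hψ₂] at h
    rw [profile, sq, mul_assoc, h]
    field_simp
  have hid : HasDerivAt (fun s : ℝ => (s : ℂ) ^ 2) (2 * (t : ℂ)) t := by
    simpa using (hasDerivAt_id t).ofReal_comp.fun_pow 2
  have h1 := ((hasDerivAt_avg hw' ψ x t).const_mul ((2 * σ + 2 : ℂ))).add
    ((hid.mul (hasDerivAt_avg hw ψ₂ x t)).div_const (2 * (β : ℂ)))
  rw [funext e]
  refine h1.congr_deriv ?_
  have h2 := mul_avg_laplacian hd hβ hβ1 ψ x t
  have h3 := avg_ballWeight_sub_one hd hβ hβ1 ψ₂ x t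
  have h4 : (d : ℂ) + 2 * β = 2 * σ + 4 := by exact_mod_cast hσβ
  rw [← hψ₂] at h2
  rw [h4] at h3
  field_simp
  linear_combination (-(2 * σ + 2 : ℂ)) * h2 - t * h3

theorem pderiv_comm (ψ : 𝓢(EuclideanSpace ℝ (Fin d), ℂ)) (i j : Fin d) :
    pderiv i (pderiv j ψ) = pderiv j (pderiv i ψ) := by
  have h : ∀ (i j : Fin d) x, pderiv i (pderiv j ψ) x = fderiv ℝ (fderiv ℝ ψ) x
      (EuclideanSpace.single i 1) (EuclideanSpace.single j 1) := by
    intro i j x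
    have hd2 : DifferentiableAt ℝ (fderiv ℝ ψ) x :=
      ((ψ.smooth 2).fderiv_right (m := 1) (by norm_num)).differentiable one_ne_zero x
    have := (hd2.hasFDerivAt.clm_apply
      (hasFDerivAt_const (EuclideanSpace.single j (1 : ℝ)) x)).fderiv
    rw [SchwartzMap.lineDerivOp_apply_eq_fderiv]
    change fderiv ℝ (fun y => fderiv ℝ ψ y (EuclideanSpace.single j 1)) x _ = _
    rw [this]
    simp
  ext x
  rw [h, h]
  exact ((ψ.smooth 2).contDiffAt.isSymmSndFDerivAt (by simp)) _ _

theorem contDiff_profile (n : ℕ) {W : EuclideanSpace ℝ (Fin d) → ℝ} (hW : IsBallWeight W)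
    (σ : ℝ) (ψ : 𝓢(EuclideanSpace ℝ (Fin d), ℂ)) :
    ContDiff ℝ n (fun q : EuclideanSpace ℝ (Fin d) × ℝ => profile W σ ψ q.1 q.2) := by
  unfold profile avgDeriv
  exact (contDiff_const.mul (contDiff_avg n hW ψ)).add
    ((Complex.ofRealCLM.contDiff.comp contDiff_snd).mul
      (ContDiff.sum fun i _ => contDiff_avg n (hW.mul_coord i) _))

theorem contDiff_profile_space (n : ℕ) {W : EuclideanSpace ℝ (Fin d) → ℝ} (hW : IsBallWeight W)
    (σ : ℝ) (ψ : 𝓢(EuclideanSpace ℝ (Fin d), ℂ)) (t : ℝ) :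
    ContDiff ℝ n (fun x => profile W σ ψ x t) :=
  (contDiff_profile n hW σ ψ).comp (f := fun x => (x, t)) (contDiff_id.prodMk contDiff_const)

theorem contDiff_avg_space (n : ℕ) {W : EuclideanSpace ℝ (Fin d) → ℝ} (hW : IsBallWeight W)
    (ψ : 𝓢(EuclideanSpace ℝ (Fin d), ℂ)) (t : ℝ) :
    ContDiff ℝ n (fun x => avg W ψ x t) :=
  (contDiff_avg n hW ψ).comp (f := fun x => (x, t)) (contDiff_id.prodMk contDiff_const)

theorem fderiv_profile_single {W : EuclideanSpace ℝ (Fin d) → ℝ} (hW : IsBallWeight W) (σ : ℝ)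
    (ψ : 𝓢(EuclideanSpace ℝ (Fin d), ℂ)) (x : EuclideanSpace ℝ (Fin d)) (t : ℝ) (i : Fin d) :
    fderiv ℝ (fun y => profile W σ ψ y t) x (EuclideanSpace.single i 1) =
      profile W σ (pderiv i ψ) x t := by
  have hdiff : ∀ {V : EuclideanSpace ℝ (Fin d) → ℝ} (_ : IsBallWeight V)
      (χ : 𝓢(EuclideanSpace ℝ (Fin d), ℂ)),
      HasFDerivAt (fun y => avg V χ y t) (fderiv ℝ (fun y => avg V χ y t) x) x := fun hV χ =>
    ((contDiff_avg_space 1 hV χ t).differentiable one_ne_zero x).hasFDerivAt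
  have h := ((hdiff hW ψ).const_mul (2 * σ + 2 : ℂ)).fun_add
    ((HasFDerivAt.fun_sum (u := Finset.univ)
      fun j _ => hdiff (hW.mul_coord j) (pderiv j ψ)).const_mul (t : ℂ))
  have h' : fderiv ℝ (fun y => profile W σ ψ y t) x = _ := h.fderiv
  rw [h']
  simp only [_root_.add_apply, _root_.smul_apply, _root_.sum_apply, smul_eq_mul,
    fderiv_avg_single hW, fun j => fderiv_avg_single (hW.mul_coord j), pderiv_comm ψ i]
  rfl

theorem profile_sum {ι : Type*} {W : EuclideanSpace ℝ (Fin d) → ℝ} (hW : IsBallWeight W) (σ : ℝ)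
    (s : Finset ι) (ψ : ι → 𝓢(EuclideanSpace ℝ (Fin d), ℂ)) (x : EuclideanSpace ℝ (Fin d))
    (t : ℝ) : profile W σ (∑ i ∈ s, ψ i) x t = ∑ i ∈ s, profile W σ (ψ i) x t := by
  unfold profile avgDeriv
  rw [avg_sum hW, Finset.sum_add_distrib, ← Finset.mul_sum, ← Finset.mul_sum,
    Finset.sum_comm]
  congr 3
  funext j
  rw [← avg_sum (hW.mul_coord j)]
  simp only [pderiv, lineDerivOp_sum]

theorem laplacian_eq_sum_fderiv {f : EuclideanSpace ℝ (Fin d) → ℂ} (hf : ContDiff ℝ 2 f)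
    (x : EuclideanSpace ℝ (Fin d)) :
    Laplacian.laplacian f x = ∑ i, fderiv ℝ (fun y => fderiv ℝ f y (EuclideanSpace.single i 1)) x
      (EuclideanSpace.single i 1) := by
  rw [InnerProductSpace.laplacian_eq_iteratedFDeriv_orthonormalBasis f
    (EuclideanSpace.basisFun (Fin d) ℝ)]
  refine Finset.sum_congr rfl fun i _ => ?_
  have hd2 : DifferentiableAt ℝ (fderiv ℝ f) x :=
    (hf.fderiv_right (m := 1) (by norm_num)).differentiable one_ne_zero x
  have := (hd2.hasFDerivAt.clm_apply
    (hasFDerivAt_const (EuclideanSpace.single i (1 : ℝ)) x)).fderiv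
  rw [this, iteratedFDeriv_two_apply]
  simp

/-- Averaging over translates commutes with spatial derivatives, and the coefficients of the profile
depend on t alone. -/
theorem laplacian_profile {W : EuclideanSpace ℝ (Fin d) → ℝ} (hW : IsBallWeight W) (σ : ℝ)
    (ψ : 𝓢(EuclideanSpace ℝ (Fin d), ℂ)) (x : EuclideanSpace ℝ (Fin d)) (t : ℝ) :
    Laplacian.laplacian (fun y => profile W σ ψ y t) x =
      profile W σ (Laplacian.laplacian ψ) x t := by
  rw [laplacian_eq_sum_fderiv (contDiff_profile_space 2 hW σ ψ t), laplacian_eq_sum_pderiv,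
    profile_sum hW]
  simp_rw [fderiv_profile_single hW]

/-- Two integrations by parts in each coordinate; compact support of φ makes every product
integrable, so f needs no decay. -/
theorem isWeakLaplacian_laplacian {f : EuclideanSpace ℝ (Fin d) → ℂ} (hf : ContDiff ℝ 2 f) :
    IsWeakLaplacian f (Laplacian.laplacian f) := by
  intro φ hφ hφc
  have hφ2 : ContDiff ℝ 2 φ := by exact_mod_cast contDiff_infty.1 hφ 2
  have hD : ∀ {k : EuclideanSpace ℝ (Fin d) → ℂ} (_ : ContDiff ℝ 2 k) (i : Fin d),
      ContDiff ℝ 1 fun y => fderiv ℝ k y (EuclideanSpace.single i 1) := fun hk i =>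
    (hk.fderiv_right (m := 1) (by norm_num)).clm_apply contDiff_const
  have hDD : ∀ {k : EuclideanSpace ℝ (Fin d) → ℂ} (_ : ContDiff ℝ 1 k) (i : Fin d),
      Continuous fun y => fderiv ℝ k y (EuclideanSpace.single i 1) := fun hk i =>
    (hk.continuous_fderiv one_ne_zero).clm_apply continuous_const
  have hint : ∀ {a b : EuclideanSpace ℝ (Fin d) → ℂ}, Continuous a → Continuous b →
      HasCompactSupport b → Integrable fun x => a x * b x := fun ha hb hc =>
    (ha.mul hb).integrable_of_hasCompactSupport hc.mul_left
  have hs1 : ∀ i : Fin d, HasCompactSupport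
      fun y => fderiv ℝ φ y (EuclideanSpace.single i 1) := fun i => hφc.fderiv_apply ℝ _
  have hs2 : ∀ i : Fin d, HasCompactSupport fun y => fderiv ℝ
      (fun y => fderiv ℝ φ y (EuclideanSpace.single i 1)) y (EuclideanSpace.single i 1) :=
    fun i => (hs1 i).fderiv_apply ℝ _
  have hf1 : ContDiff ℝ 1 f := hf.of_le one_le_two
  have hφ1 : ContDiff ℝ 1 φ := hφ2.of_le one_le_two
  have key : ∀ i : Fin d, ∫ x, f x * fderiv ℝ
      (fun y => fderiv ℝ φ y (EuclideanSpace.single i 1)) x (EuclideanSpace.single i 1) =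
      ∫ x, fderiv ℝ (fun y => fderiv ℝ f y (EuclideanSpace.single i 1)) x
        (EuclideanSpace.single i 1) * φ x := by
    intro i
    rw [integral_mul_fderiv_eq_neg_fderiv_mul_of_integrable
        (hint (hDD hf1 i) (hD hφ2 i).continuous (hs1 i))
        (hint hf1.continuous (hDD (hD hφ2 i) i) (hs2 i))
        (hint hf1.continuous (hD hφ2 i).continuous (hs1 i))
        (fun x _ => hf1.differentiable one_ne_zero x)
        (fun x _ => (hD hφ2 i).differentiable one_ne_zero x),
      integral_mul_fderiv_eq_neg_fderiv_mul_of_integrable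
        (hint (hDD (hD hf i) i) hφ1.continuous hφc)
        (hint (hD hf i).continuous (hD hφ2 i).continuous (hs1 i))
        (hint (hD hf i).continuous hφ1.continuous hφc)
        (fun x _ => (hD hf i).differentiable one_ne_zero x)
        (fun x _ => hφ1.differentiable one_ne_zero x), neg_neg]
  simp_rw [laplacian_eq_sum_fderiv hf, laplacian_eq_sum_fderiv hφ2, Finset.mul_sum,
    Finset.sum_mul]
  rw [integral_finsetSum _ fun i _ => hint hf1.continuous (hDD (hD hφ2 i) i) (hs2 i),
    integral_finsetSum _ fun i _ => hint (hDD (hD hf i) i) hφ1.continuous hφc]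
  exact Finset.sum_congr rfl fun i _ => key i

/-! ### One-variable calculus for f = C t^(2σ) n with n' = t l -/

section Time

variable {σ C : ℝ} {n l l' f : ℝ → ℂ}

theorem hasDerivAt_ofReal_const_mul_rpow (c p : ℝ) {t : ℝ} (ht : 0 < t) :
    HasDerivAt (fun s : ℝ => ((c * s ^ p : ℝ) : ℂ)) ((c * (p * t ^ (p - 1)) : ℝ) : ℂ) t :=
  ((Real.hasDerivAt_rpow_const (Or.inl ht.ne')).const_mul c).ofReal_comp

theorem hasDerivAt_rpow_mul (hf : ∀ t, 0 < t → f t = ((C * t ^ (2 * σ) : ℝ) : ℂ) * n t)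
    (hn : ∀ t : ℝ, HasDerivAt n (t * l t) t) {t : ℝ} (ht : 0 < t) :
    HasDerivAt f (((2 * σ * C * t ^ (2 * σ - 1) : ℝ) : ℂ) * n t +
      ((C * t ^ (2 * σ + 1) : ℝ) : ℂ) * l t) t := by
  have h := (hasDerivAt_ofReal_const_mul_rpow C (2 * σ) ht).fun_mul (hn t)
  have e : f =ᶠ[𝓝 t] fun s => ((C * s ^ (2 * σ) : ℝ) : ℂ) * n s := by
    filter_upwards [lt_mem_nhds ht] with s hs using hf s hs
  refine (h.congr_of_eventuallyEq e).congr_deriv ?_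
  rw [Real.rpow_add_one ht.ne']
  push_cast
  ring

/-- The operator is t^(2σ-1) ∂_t t^(1-2σ) ∂_t, and t^(1-2σ) f' = C (2σ n + t² l), whose derivative
is C t ((2σ+2) l + t l'). -/
theorem besselTimeOp_rpow_mul (hf : ∀ t, 0 < t → f t = ((C * t ^ (2 * σ) : ℝ) : ℂ) * n t)
    (hn : ∀ t : ℝ, HasDerivAt n (t * l t) t) (hl : ∀ t, HasDerivAt l (l' t) t)
    {t : ℝ} (ht : 0 < t) :
    besselTimeOp σ f t = ((C * t ^ (2 * σ) : ℝ) : ℂ) * ((2 * σ + 2) * l t + t * l' t) := by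
  have e : deriv f =ᶠ[𝓝 t] fun s => ((2 * σ * C * s ^ (2 * σ - 1) : ℝ) : ℂ) * n s +
      ((C * s ^ (2 * σ + 1) : ℝ) : ℂ) * l s := by
    filter_upwards [lt_mem_nhds ht] with s hs using (hasDerivAt_rpow_mul hf hn hs).deriv
  have h := ((hasDerivAt_ofReal_const_mul_rpow (2 * σ * C) (2 * σ - 1) ht).fun_mul (hn t)).fun_add
    ((hasDerivAt_ofReal_const_mul_rpow C (2 * σ + 1) ht).fun_mul (hl t))
  rw [besselTimeOp, e.deriv_eq, h.deriv, e.eq_of_nhds]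
  have htc : (t : ℂ) ≠ 0 := by exact_mod_cast ht.ne'
  rw [Real.rpow_add_one ht.ne', Real.rpow_sub_one ht.ne', Real.rpow_sub_one ht.ne',
    Real.rpow_sub_one ht.ne', Real.rpow_add_one ht.ne']
  push_cast
  field_simp
  ring

theorem tendsto_rpow_mul_zero (hσ : 0 < σ)
    (hf : ∀ t, 0 < t → f t = ((C * t ^ (2 * σ) : ℝ) : ℂ) * n t)
    (hn : ∀ t : ℝ, HasDerivAt n (t * l t) t) : Tendsto f (𝓝[>] 0) (𝓝 0) := by
  have h1 : ContinuousAt (fun t : ℝ => ((C * t ^ (2 * σ) : ℝ) : ℂ) * n t) 0 := by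
    refine ContinuousAt.mul (Complex.continuous_ofReal.continuousAt.comp
      (continuousAt_const.mul (Real.continuousAt_rpow_const _ _ (Or.inr (by positivity)))))
      (hn 0).continuousAt
  have h2 := h1.tendsto.mono_left (nhdsWithin_le_nhds (s := Ioi 0))
  rw [Real.zero_rpow (by positivity), mul_zero, Complex.ofReal_zero, zero_mul] at h2
  refine h2.congr' ?_
  filter_upwards [self_mem_nhdsWithin] with t ht using (hf t ht).symm

/-- For t > 0 the quantity equals C n + C t² l / (2σ), and the second term dies because l is
continuous at 0. -/
theorem tendsto_fracTimeDeriv_rpow_mul (hσ : 0 < σ)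
    (hf : ∀ t, 0 < t → f t = ((C * t ^ (2 * σ) : ℝ) : ℂ) * n t)
    (hn : ∀ t : ℝ, HasDerivAt n (t * l t) t) (hl : ContinuousAt l 0) :
    Tendsto (fracTimeDeriv σ f) (𝓝[>] 0) (𝓝 (C * n 0)) := by
  have h1 : ContinuousAt (fun t : ℝ => (C : ℂ) * n t + C / (2 * σ) * (t : ℂ) ^ 2 * l t) 0 := by
    have := (hn 0).continuousAt
    have h3 : ContinuousAt (fun t : ℝ => (C : ℂ) / (2 * σ) * (t : ℂ) ^ 2) 0 := by fun_prop
    exact (continuousAt_const.mul this).add (h3.mul hl)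
  have h2 := h1.tendsto.mono_left (nhdsWithin_le_nhds (s := Ioi 0))
  simp only [Complex.ofReal_zero, ne_eq, OfNat.ofNat_ne_zero, not_false_eq_true, zero_pow,
    mul_zero, zero_mul, add_zero] at h2
  refine h2.congr' ?_
  filter_upwards [self_mem_nhdsWithin] with t ht
  have ht : 0 < t := ht
  rw [fracTimeDeriv, (hasDerivAt_rpow_mul hf hn ht).deriv, mul_add, ← mul_assoc, ← mul_assoc,
    ← Complex.ofReal_mul, ← Complex.ofReal_mul]
  have e1 : 1 / (2 * σ) * t ^ (1 - 2 * σ) * (2 * σ * C * t ^ (2 * σ - 1)) = C := by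
    have : t ^ (1 - 2 * σ) * t ^ (2 * σ - 1) = 1 := by
      rw [← Real.rpow_add ht]; simp
    field_simp
    linear_combination C * this
  have e2 : 1 / (2 * σ) * t ^ (1 - 2 * σ) * (C * t ^ (2 * σ + 1)) = C / (2 * σ) * t ^ 2 := by
    have : t ^ (1 - 2 * σ) * t ^ (2 * σ + 1) = t ^ 2 := by
      rw [← Real.rpow_add ht, ← Real.rpow_natCast]
      congr 1
      push_cast
      ring
    field_simp
    linear_combination C * this
  rw [e1, e2]
  push_cast
  rfl

theorem contDiffOn_rpow_mul (hf : ∀ t, 0 < t → f t = ((C * t ^ (2 * σ) : ℝ) : ℂ) * n t)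
    (hn : ∀ t : ℝ, HasDerivAt n (t * l t) t) (hl : ∀ t, HasDerivAt l (l' t) t)
    (hl' : Continuous l') : ContDiffOn ℝ 2 f (Ioi 0) := by
  have h1 : ContDiff ℝ 1 l := contDiff_one_iff_deriv.2
    ⟨fun t => (hl t).differentiableAt, by rwa [funext fun t => (hl t).deriv]⟩
  have h2 : ContDiff ℝ 2 n := by
    rw [show (2 : ℕ∞ω) = 1 + 1 by norm_num, contDiff_succ_iff_deriv]
    refine ⟨fun t => (hn t).differentiableAt, by simp, ?_⟩
    rw [funext fun t => (hn t).deriv]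
    exact Complex.ofRealCLM.contDiff.mul h1
  refine ContDiffOn.congr (ContDiffOn.mul ?_ h2.contDiffOn) fun t ht => hf t ht
  exact Complex.ofRealCLM.contDiff.comp_contDiffOn
    (contDiffOn_const.mul (contDiffOn_id.rpow_const_of_ne fun t ht => (ne_of_gt ht)))

end Time

/-! ### Spatial decay and differentiation of L² pairings -/

/-- The integrable and square integrable function `(1 + |x|)^(-(d+1))`. -/
noncomputable def decayWeight (x : EuclideanSpace ℝ (Fin d)) : ℝ := (1 + ‖x‖) ^ (-((d : ℝ) + 1))

theorem decayWeight_pos (x : EuclideanSpace ℝ (Fin d)) : 0 < decayWeight x := by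
  unfold decayWeight
  positivity

theorem continuous_decayWeight : Continuous (decayWeight (d := d)) := by
  unfold decayWeight
  exact Continuous.rpow_const (by fun_prop) fun x => Or.inl (by positivity)

theorem memLp_decayWeight : MemLp (decayWeight (d := d)) 2 volume := by
  rw [memLp_two_iff_integrable_sq continuous_decayWeight.aestronglyMeasurable]
  have h : Integrable (decayWeight (d := d)) volume :=
    integrable_one_add_norm (by rw [finrank_euclideanSpace_fin]; linarith)
  refine h.mono (continuous_decayWeight.pow 2).aestronglyMeasurable
    (Eventually.of_forall fun x => ?_)
  have h1 : decayWeight x ≤ 1 :=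
    Real.rpow_le_one_of_one_le_of_nonpos (by linarith [norm_nonneg x])
      (by linarith [(Nat.cast_nonneg d : (0 : ℝ) ≤ d)])
  have h0 := decayWeight_pos x
  rw [Real.norm_of_nonneg h0.le, Real.norm_of_nonneg (by positivity)]
  nlinarith

/-- Continuity in space together with a decay bound that is locally uniform in time. -/
structure LocallyDominated (Φ : EuclideanSpace ℝ (Fin d) → ℝ → ℂ) : Prop where
  continuous : ∀ t, Continuous fun x => Φ x t
  bound : ∀ T : ℝ, ∃ K, ∀ x t, |t| ≤ T → ‖Φ x t‖ ≤ K * decayWeight x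

theorem LocallyDominated.add {Φ Ψ : EuclideanSpace ℝ (Fin d) → ℝ → ℂ} (hΦ : LocallyDominated Φ)
    (hΨ : LocallyDominated Ψ) : LocallyDominated fun x t => Φ x t + Ψ x t where
  continuous t := (hΦ.continuous t).add (hΨ.continuous t)
  bound T := by
    obtain ⟨K, hK⟩ := hΦ.bound T
    obtain ⟨K', hK'⟩ := hΨ.bound T
    refine ⟨K + K', fun x t ht => (norm_add_le _ _).trans ?_⟩
    rw [add_mul]
    exact add_le_add (hK x t ht) (hK' x t ht)

theorem LocallyDominated.sum {ι : Type*} {s : Finset ι}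
    {Φ : ι → EuclideanSpace ℝ (Fin d) → ℝ → ℂ}
    (hΦ : ∀ i, LocallyDominated (Φ i)) : LocallyDominated fun x t => ∑ i ∈ s, Φ i x t := by
  classical
  induction s using Finset.induction_on with
  | empty => exact ⟨fun t => by simpa using continuous_const, fun T => ⟨0, by simp⟩⟩
  | insert i s hi ih =>
    simp_rw [Finset.sum_insert hi]
    exact (hΦ i).add ih

theorem LocallyDominated.mul_left {Φ : EuclideanSpace ℝ (Fin d) → ℝ → ℂ}
    (hΦ : LocallyDominated Φ) {c : ℝ → ℂ} (hc : Continuous c) :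
    LocallyDominated fun x t => c t * Φ x t where
  continuous t := continuous_const.mul (hΦ.continuous t)
  bound T := by
    obtain ⟨K, hK⟩ := hΦ.bound T
    obtain ⟨M, hM⟩ := (isCompact_Icc (a := -T) (b := T)).exists_bound_of_continuousOn hc.continuousOn
    refine ⟨M * K, fun x t ht => ?_⟩
    have h1 := hM t (abs_le.1 ht)
    rw [norm_mul, mul_assoc]
    exact mul_le_mul h1 (hK x t ht) (norm_nonneg _) ((norm_nonneg _).trans h1)

theorem LocallyDominated.memLp {Φ : EuclideanSpace ℝ (Fin d) → ℝ → ℂ}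
    (hΦ : LocallyDominated Φ) (t : ℝ) : MemLp (fun x => Φ x t) 2 volume := by
  obtain ⟨K, hK⟩ := hΦ.bound |t|
  refine (memLp_decayWeight.const_mul K).mono' (hΦ.continuous t).aestronglyMeasurable
    (Eventually.of_forall fun x => hK x t le_rfl)

theorem locallyDominated_avg {W : EuclideanSpace ℝ (Fin d) → ℝ} (hW : IsBallWeight W)
    (ψ : 𝓢(EuclideanSpace ℝ (Fin d), ℂ)) : LocallyDominated (avg W ψ) where
  continuous t := (contDiff_avg_space 0 hW ψ t).continuous
  bound T := by
    rcases lt_or_ge T 0 with hT | hT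
    · exact ⟨0, fun x t ht => absurd (abs_nonneg t) (not_le.2 (ht.trans_lt hT))⟩
    set K := 2 ^ (d + 1) *
      ((Finset.Iic (d + 1, 0)).sup fun m => SchwartzMap.seminorm ℝ m.1 m.2) ψ
    have hK : ∀ y, (1 + ‖y‖) ^ (d + 1) * ‖ψ y‖ ≤ K := fun y => by
      simpa using SchwartzMap.one_add_le_sup_seminorm_apply (𝕜 := ℝ) (m := (d + 1, 0))
        le_rfl le_rfl ψ y
    have hdw : ∀ x : EuclideanSpace ℝ (Fin d), decayWeight x = ((1 + ‖x‖) ^ (d + 1))⁻¹ := by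
      intro x
      rw [decayWeight, Real.rpow_neg (by positivity), ← Nat.cast_add_one, Real.rpow_natCast]
    refine ⟨(∫ z, ‖W z‖) * ((1 + T) ^ (d + 1) * K), fun x t ht => ?_⟩
    have hpt : ∀ z, ‖W z • ψ (x + t • z)‖ ≤
        ‖W z‖ * ((1 + T) ^ (d + 1) * K * decayWeight x) := by
      intro z
      by_cases hz : 1 < ‖z‖
      · rw [hW.eq_zero z hz]; simp
      rw [norm_smul]
      gcongr
      -- A shift of length at most T costs only a factor 1 + T, so the decay of ψ at x + tz passes
      -- to x.
      have h1 : 1 + ‖x‖ ≤ (1 + T) * (1 + ‖x + t • z‖) := by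
        have h2 : ‖x‖ ≤ ‖x + t • z‖ + ‖t • z‖ := by
          simpa using norm_sub_le (x + t • z) (t • z)
        have h3 : ‖t • z‖ ≤ T := by
          rw [norm_smul]
          exact (mul_le_of_le_one_right (norm_nonneg _) (not_lt.1 hz)).trans ht
        nlinarith [norm_nonneg (x + t • z)]
      rw [hdw, ← div_eq_mul_inv, le_div_iff₀ (by positivity)]
      calc ‖ψ (x + t • z)‖ * (1 + ‖x‖) ^ (d + 1)
          ≤ ‖ψ (x + t • z)‖ * ((1 + T) * (1 + ‖x + t • z‖)) ^ (d + 1) := by gcongr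
        _ = (1 + T) ^ (d + 1) * ((1 + ‖x + t • z‖) ^ (d + 1) * ‖ψ (x + t • z)‖) := by
          rw [mul_pow]; ring
        _ ≤ _ := by gcongr; exact hK _
    refine (norm_integral_le_of_norm_le (hW.integrable.norm.mul_const _)
      (Eventually.of_forall hpt)).trans_eq ?_
    rw [integral_mul_const]
    ring

theorem locallyDominated_avgDeriv {W : EuclideanSpace ℝ (Fin d) → ℝ} (hW : IsBallWeight W)
    (ψ : 𝓢(EuclideanSpace ℝ (Fin d), ℂ)) : LocallyDominated (avgDeriv W ψ) :=
  LocallyDominated.sum fun i => locallyDominated_avg (hW.mul_coord i) (pderiv i ψ)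

theorem locallyDominated_profile {W : EuclideanSpace ℝ (Fin d) → ℝ} (hW : IsBallWeight W) (σ : ℝ)
    (ψ : 𝓢(EuclideanSpace ℝ (Fin d), ℂ)) : LocallyDominated (profile W σ ψ) :=
  ((locallyDominated_avg hW ψ).mul_left continuous_const).add
    ((locallyDominated_avgDeriv hW ψ).mul_left Complex.continuous_ofReal)

theorem integrable_mul_conj {f h : EuclideanSpace ℝ (Fin d) → ℂ} (hf : MemLp f 2 volume)
    (hh : MemLp h 2 volume) : Integrable fun x => f x * conj (h x) :=
  hf.integrable_mul (p := 2) (q := 2) hh.star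

/-- On the unit ball around t, the derivative of the integrand is at most K `decayWeight` |h|, a
product of two L² functions. -/
theorem hasDerivAt_pairing {Φ Φ' : EuclideanSpace ℝ (Fin d) → ℝ → ℂ}
    (hΦ : LocallyDominated Φ) (hΦ' : LocallyDominated Φ')
    (hd : ∀ x t, HasDerivAt (fun s => Φ x s) (Φ' x t) t)
    {h : EuclideanSpace ℝ (Fin d) → ℂ} (hh : MemLp h 2 volume) (t : ℝ) :
    HasDerivAt (fun s => pairing (fun x => Φ x s) h) (pairing (fun x => Φ' x t) h) t := by
  obtain ⟨K, hK⟩ := hΦ'.bound (|t| + 1)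
  have hc : AEStronglyMeasurable (fun x => conj (h x)) volume := hh.star.aestronglyMeasurable
  have hi : Integrable fun x : EuclideanSpace ℝ (Fin d) => K * decayWeight x * ‖h x‖ :=
    (memLp_decayWeight.const_mul K).integrable_mul (p := 2) (q := 2) hh.norm
  refine (hasDerivAt_integral_of_dominated_loc_of_deriv_le
    (F := fun s x => Φ x s * conj (h x)) (F' := fun s x => Φ' x s * conj (h x))
    (bound := fun x => K * decayWeight x * ‖h x‖) (Metric.ball_mem_nhds t one_pos)
    (Eventually.of_forall fun s => (hΦ.continuous s).aestronglyMeasurable.mul hc)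
    (integrable_mul_conj (hΦ.memLp t) hh) ((hΦ'.continuous t).aestronglyMeasurable.mul hc)
    (Eventually.of_forall fun x s hs => ?_) hi
    (Eventually.of_forall fun x s _ => (hd x s).mul_const _)).2
  rw [norm_mul, RCLike.norm_conj]
  gcongr
  refine hK x s ?_
  rw [Metric.mem_ball, Real.dist_eq] at hs
  have := abs_sub_abs_le_abs_sub s t
  linarith

theorem pairing_const_mul (c : ℂ) (f h : EuclideanSpace ℝ (Fin d) → ℂ) :
    pairing (fun x => c * f x) h = c * pairing f h := by
  unfold pairing
  simp_rw [mul_assoc]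
  exact integral_const_mul _ _

theorem pairing_add {f₁ f₂ h : EuclideanSpace ℝ (Fin d) → ℂ} (h₁ : MemLp f₁ 2 volume)
    (h₂ : MemLp f₂ 2 volume) (hh : MemLp h 2 volume) :
    pairing (fun x => f₁ x + f₂ x) h = pairing f₁ h + pairing f₂ h := by
  unfold pairing
  simp_rw [add_mul]
  exact integral_add (integrable_mul_conj h₁ hh) (integrable_mul_conj h₂ hh)

/-! ### The normalising constant and the rescaling of the kernel to the unit ball -/

theorem kernelConst_mul_integral_ballWeight (hd : 0 < d) {σ : ℝ} (hσ0 : 0 < σ) (hσ1 : σ < 1)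
    (h1 : 1 < (d : ℝ) / 2 - σ) (h2 : (d : ℝ) / 2 - σ < 2) :
    kernelConst d σ * ((2 * σ + 2) * ∫ z, ballWeight d (-((d : ℝ) / 2 - σ - 1)) z) = 1 := by
  set α := (d : ℝ) / 2 - σ - 1 with hα
  have hα0 : 0 < α := by linarith
  have hα1 : α < 1 := by linarith
  rw [integral_ballWeight hd (by linarith), kernelConst, ← hα,
    show (d : ℝ) / 2 + -α + 1 = σ + 1 + 1 by rw [hα]; ring, show -α + 1 = 1 - α by ring,
    Real.Gamma_add_one (s := σ + 1) (by positivity), Real.Gamma_add_one hσ0.ne']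
  have r1 := Real.Gamma_mul_Gamma_one_sub α
  have r2 := Real.Gamma_mul_Gamma_one_sub σ
  have s1 : 0 < Real.sin (Real.pi * α) :=
    Real.sin_pos_of_pos_of_lt_pi (by positivity) (by nlinarith [Real.pi_pos])
  have s2 : 0 < Real.sin (Real.pi * σ) :=
    Real.sin_pos_of_pos_of_lt_pi (by positivity) (by nlinarith [Real.pi_pos])
  have g1 := Real.Gamma_pos_of_pos hσ0
  have g2 := Real.Gamma_pos_of_pos (show 0 < 1 - σ by linarith)
  have hp := Real.rpow_pos_of_pos Real.pi_pos ((d : ℝ) / 2)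
  rw [eq_div_iff s1.ne'] at r1
  rw [eq_div_iff s2.ne'] at r2
  rw [mul_comm Real.pi] at r1 r2 s1 s2
  have c1 := s1.ne'
  have c2 := s2.ne'
  field_simp
  -- By reflection, Γ(α) Γ(1-α) sin(απ) and Γ(σ) Γ(1-σ) sin(σπ) both equal π.
  linear_combination r1 - r2

/-- From t² - |x-y|² = t² (1 - |z|²) and y - x = tz. The indicator and the ball weight vanish
together, so the identity holds for every z and the change of variables can be made on the whole
space. -/
theorem kernelIntegrand_add_smul {σ : ℝ} (g : 𝓢(EuclideanSpace ℝ (Fin d), ℂ))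
    (x : EuclideanSpace ℝ (Fin d)) {t : ℝ} (ht : 0 < t) (z : EuclideanSpace ℝ (Fin d)) :
    (Metric.ball x t).indicator (kernelIntegrand σ g x t) (x + t • z) =
      ((t ^ (-(2 * ((d : ℝ) / 2 - σ - 1))) : ℝ) : ℂ) *
        ((2 * σ + 2) * ballWeight d (-((d : ℝ) / 2 - σ - 1)) z • g (x + t • z) +
          t * ∑ i, (ballWeight d (-((d : ℝ) / 2 - σ - 1)) z * z i) • pderiv i g (x + t • z)) := by
  set α := (d : ℝ) / 2 - σ - 1 with hα
  have hn : ‖x - (x + t • z)‖ = t * ‖z‖ := by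
    rw [sub_add_cancel_left, norm_neg, norm_smul, Real.norm_of_nonneg ht.le]
  have hmem : x + t • z ∈ Metric.ball x t ↔ ‖z‖ < 1 := by
    rw [Metric.mem_ball', dist_eq_norm, hn, mul_lt_iff_lt_one_right ht]
  by_cases hz : ‖z‖ < 1
  · have h0 := one_sub_norm_sq_pos_iff.2 hz
    rw [indicator_of_mem (hmem.2 hz), kernelIntegrand, hn, ← hα, ballWeight, if_pos hz,
      show t ^ 2 - (t * ‖z‖) ^ 2 = t ^ 2 * (1 - ‖z‖ ^ 2) by ring,
      Real.mul_rpow (by positivity) h0.le, ← Real.rpow_natCast_mul ht.le, Real.rpow_neg ht.le,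
      Real.rpow_neg h0.le, add_sub_cancel_left, map_smul, fderiv_apply_eq_sum]
    have e : ∑ i, (((1 - ‖z‖ ^ 2) ^ α)⁻¹ * z i) • pderiv i g (x + t • z) =
        ((((1 - ‖z‖ ^ 2) ^ α)⁻¹ : ℝ) : ℂ) * ∑ i, z i • pderiv i g (x + t • z) := by
      simp_rw [mul_smul]
      rw [← Finset.smul_sum, Complex.real_smul]
    rw [e, Complex.real_smul, Complex.real_smul]
    push_cast
    rw [div_eq_mul_inv, mul_inv]
    ring
  · rw [indicator_of_notMem (mt hmem.1 hz), ballWeight, if_neg hz]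
    simp

theorem integrable_profile_integrand {W : EuclideanSpace ℝ (Fin d) → ℝ} (hW : IsBallWeight W)
    (σ : ℝ) (ψ : 𝓢(EuclideanSpace ℝ (Fin d), ℂ)) (x : EuclideanSpace ℝ (Fin d)) (t : ℝ) :
    Integrable (fun z => (2 * σ + 2 : ℂ) * W z • ψ (x + t • z)) ∧
    Integrable (fun z => (t : ℂ) * ∑ i, (W z * z i) • pderiv i ψ (x + t • z)) :=
  ⟨(hW.integrable_smul ψ x t).const_mul _,
    (integrable_finsetSum _ fun i _ => (hW.mul_coord i).integrable_smul _ x t).const_mul _⟩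

theorem integral_profile_integrand {W : EuclideanSpace ℝ (Fin d) → ℝ} (hW : IsBallWeight W)
    (σ : ℝ) (ψ : 𝓢(EuclideanSpace ℝ (Fin d), ℂ)) (x : EuclideanSpace ℝ (Fin d)) (t : ℝ) :
    ∫ z, ((2 * σ + 2 : ℂ) * W z • ψ (x + t • z) +
      t * ∑ i, (W z * z i) • pderiv i ψ (x + t • z)) = profile W σ ψ x t := by
  have h := integrable_profile_integrand hW σ ψ x t
  rw [integral_add h.1 h.2, integral_const_mul, integral_const_mul,
    integral_finsetSum _ fun i _ => (hW.mul_coord i).integrable_smul _ x t]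
  rfl

theorem integrable_comp_affine_iff {f : EuclideanSpace ℝ (Fin d) → ℂ}
    (x : EuclideanSpace ℝ (Fin d)) {t : ℝ} (ht : t ≠ 0) :
    Integrable (fun z => f (x + t • z)) ↔ Integrable f := by
  rw [integrable_comp_smul_iff volume (fun y => f (x + y)) ht]
  exact (measurePreserving_add_left volume x).integrable_comp_emb (measurableEmbedding_addLeft x)

theorem integral_comp_affine (f : EuclideanSpace ℝ (Fin d) → ℂ)
    (x : EuclideanSpace ℝ (Fin d)) {t : ℝ} (ht : 0 < t) :
    ∫ y, f y = t ^ d * ∫ z, f (x + t • z) := by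
  rw [Measure.integral_comp_smul volume (fun y => f (x + y)) t, integral_add_left_eq_self,
    finrank_euclideanSpace_fin, abs_of_pos (by positivity), Complex.real_smul]
  have : (t : ℂ) ≠ 0 := by exact_mod_cast ht.ne'
  push_cast
  field_simp

theorem integrableOn_kernelIntegrand (hd : 0 < d) {σ : ℝ} (h2 : (d : ℝ) / 2 - σ < 2)
    (g : 𝓢(EuclideanSpace ℝ (Fin d), ℂ)) (x : EuclideanSpace ℝ (Fin d)) {t : ℝ} (ht : 0 < t) :
    IntegrableOn (kernelIntegrand σ g x t) (Metric.ball x t) := by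
  have hw := isBallWeight_ballWeight hd (show -1 < -((d : ℝ) / 2 - σ - 1) by linarith)
  have h := integrable_profile_integrand hw σ g x t
  rw [← integrable_indicator_iff measurableSet_ball, ← integrable_comp_affine_iff x ht.ne']
  simp_rw [kernelIntegrand_add_smul g x ht]
  exact (h.1.add h.2).const_mul _

theorem kernel_representation_eq (hd : 0 < d) {σ : ℝ} (h2 : (d : ℝ) / 2 - σ < 2)
    (g : 𝓢(EuclideanSpace ℝ (Fin d), ℂ)) (x : EuclideanSpace ℝ (Fin d)) {t : ℝ} (ht : 0 < t) :
    ((kernelConst d σ * (1 / t ^ 2) : ℝ) : ℂ) *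
        ∫ y in Metric.ball x t, kernelIntegrand σ g x t y =
      ((kernelConst d σ * t ^ (2 * σ) : ℝ) : ℂ) *
        profile (ballWeight d (-((d : ℝ) / 2 - σ - 1))) σ g x t := by
  have hw := isBallWeight_ballWeight hd (show -1 < -((d : ℝ) / 2 - σ - 1) by linarith)
  rw [← integral_indicator measurableSet_ball, integral_comp_affine _ x ht]
  simp_rw [kernelIntegrand_add_smul g x ht]
  rw [integral_const_mul, integral_profile_integrand hw]
  -- Exponent count: -2 + d - 2α = 2σ.
  have e : t ^ (2 * σ) = 1 / t ^ 2 * (t ^ d * t ^ (-(2 * ((d : ℝ) / 2 - σ - 1)))) := by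
    rw [one_div, ← Real.rpow_natCast t 2, ← Real.rpow_neg ht.le, ← Real.rpow_natCast t d,
      ← Real.rpow_add ht, ← Real.rpow_add ht]
    congr 1
    push_cast
    ring
  rw [e]
  push_cast
  ring

theorem profile_zero (W : EuclideanSpace ℝ (Fin d) → ℝ) (σ : ℝ)
    (ψ : 𝓢(EuclideanSpace ℝ (Fin d), ℂ)) (x : EuclideanSpace ℝ (Fin d)) :
    profile W σ ψ x 0 = (((2 * σ + 2) * ∫ z, W z : ℝ) : ℂ) * ψ x := by
  simp only [profile, avg, zero_smul, add_zero, Complex.ofReal_zero, zero_mul]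
  rw [integral_smul_const, Complex.real_smul]
  push_cast
  ring

/-! ### The classical and weak solutions -/

section Solution

variable {σ β C : ℝ} {u : EuclideanSpace ℝ (Fin d) → ℝ → ℂ}

theorem isClassicalNeumannSolution_profile (hd : 0 < d) (hσ : 0 < σ) (hβ : 0 < β) (hβ1 : β < 1)
    (hσβ : d + 2 * β = 2 * σ + 4)
    (hC : C * ((2 * σ + 2) * ∫ z, ballWeight d (β - 1) z) = 1)
    (g : 𝓢(EuclideanSpace ℝ (Fin d), ℂ))
    (hu : ∀ x t, 0 < t →
      u x t = ((C * t ^ (2 * σ) : ℝ) : ℂ) * profile (ballWeight d (β - 1)) σ g x t) :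
    IsClassicalNeumannSolution σ g u := by
  have hw := isBallWeight_ballWeight hd (show -1 < β - 1 by linarith)
  have hn := hasDerivAt_profile hd hβ hβ1 hσβ g
  have hl := hasDerivAt_avg hw (Laplacian.laplacian g : 𝓢(EuclideanSpace ℝ (Fin d), ℂ))
  refine ⟨?_, fun x t ht => ?_, fun x => ?_, fun x => ?_⟩
  · refine ContDiffOn.congr (ContDiffOn.mul ?_ (contDiff_profile 2 hw σ g).contDiffOn)
      fun p hp => hu p.1 p.2 hp.2
    exact Complex.ofRealCLM.contDiff.comp_contDiffOn (contDiffOn_const.mul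
      (contDiffOn_snd.rpow_const_of_ne fun p hp => ne_of_gt hp.2))
  · rw [besselTimeOp_rpow_mul (hu x) (hn x) (hl x) ht, funext fun y => hu y t ht]
    have h := InnerProductSpace.laplacian_smul (((C * t ^ (2 * σ) : ℝ) : ℂ))
      (contDiff_profile_space 2 hw σ g t).contDiffAt (x := x)
    rw [laplacian_profile hw] at h
    exact h.symm
  · exact tendsto_rpow_mul_zero hσ (hu x) (hn x)
  · have h := tendsto_fracTimeDeriv_rpow_mul hσ (hu x) (hn x) (hl x 0).continuousAt
    rw [profile_zero, ← mul_assoc, ← Complex.ofReal_mul, hC, Complex.ofReal_one, one_mul] at h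
    exact h

theorem isWeakNeumannSolution_profile (hd : 0 < d) (hσ : 0 < σ) (hβ : 0 < β) (hβ1 : β < 1)
    (hσβ : d + 2 * β = 2 * σ + 4)
    (hC : C * ((2 * σ + 2) * ∫ z, ballWeight d (β - 1) z) = 1)
    (g : 𝓢(EuclideanSpace ℝ (Fin d), ℂ))
    (hu : ∀ x t, 0 < t →
      u x t = ((C * t ^ (2 * σ) : ℝ) : ℂ) * profile (ballWeight d (β - 1)) σ g x t) :
    IsWeakNeumannSolution σ g u := by
  have hw := isBallWeight_ballWeight hd (show -1 < β - 1 by linarith)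
  set g₂ : 𝓢(EuclideanSpace ℝ (Fin d), ℂ) := Laplacian.laplacian g
  have dA := locallyDominated_avg hw g₂
  have dA' := locallyDominated_avgDeriv hw g₂
  -- One more time derivative than the equation uses: it makes l' continuous, which the C² claim
  -- requires.
  have dA'' := LocallyDominated.sum (s := Finset.univ) fun i =>
    locallyDominated_avgDeriv (hw.mul_coord i) (pderiv i g₂)
  have hp : ∀ {h : EuclideanSpace ℝ (Fin d) → ℂ} (_ : MemLp h 2 volume) (t : ℝ), 0 < t →
      pairing (fun x => u x t) h = ((C * t ^ (2 * σ) : ℝ) : ℂ) *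
        pairing (fun x => profile (ballWeight d (β - 1)) σ g x t) h := by
    intro h _ t ht
    rw [funext fun x => hu x t ht, pairing_const_mul]
  have hn : ∀ {h : EuclideanSpace ℝ (Fin d) → ℂ} (_ : MemLp h 2 volume) (t : ℝ),
      HasDerivAt (fun s => pairing (fun x => profile (ballWeight d (β - 1)) σ g x s) h)
        (t * pairing (fun x => avg (ballWeight d (β - 1)) g₂ x t) h) t := by
    intro h hh t
    rw [← pairing_const_mul]
    exact hasDerivAt_pairing (locallyDominated_profile hw σ g)
      (dA.mul_left Complex.continuous_ofReal) (hasDerivAt_profile hd hβ hβ1 hσβ g) hh t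
  have hl : ∀ {h : EuclideanSpace ℝ (Fin d) → ℂ} (_ : MemLp h 2 volume) (t : ℝ),
      HasDerivAt (fun s => pairing (fun x => avg (ballWeight d (β - 1)) g₂ x s) h)
        (pairing (fun x => avgDeriv (ballWeight d (β - 1)) g₂ x t) h) t := fun hh t =>
    hasDerivAt_pairing dA dA' (hasDerivAt_avg hw g₂) hh t
  have hl' : ∀ {h : EuclideanSpace ℝ (Fin d) → ℂ} (_ : MemLp h 2 volume),
      Continuous fun s => pairing (fun x => avgDeriv (ballWeight d (β - 1)) g₂ x s) h := fun hh =>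
    continuous_iff_continuousAt.2 fun t =>
      (hasDerivAt_pairing dA' dA'' (hasDerivAt_avgDeriv hw g₂) hh t).continuousAt
  refine ⟨fun t ht => ?_, fun h hh => ?_, fun t ht => ?_, fun h hh => ?_, fun h hh => ?_⟩
  · rw [funext fun x => hu x t ht]
    exact ((locallyDominated_profile hw σ g).memLp t).const_mul _
  · exact contDiffOn_rpow_mul (hp hh) (hn hh) (hl hh) (hl' hh)
  · refine ⟨fun x => ((C * t ^ (2 * σ) : ℝ) : ℂ) * profile (ballWeight d (β - 1)) σ g₂ x t,
      ((locallyDominated_profile hw σ g₂).memLp t).const_mul _, ?_, fun h hh => ?_⟩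
    · rw [funext fun x => hu x t ht]
      have hc := contDiff_profile_space 2 hw σ g t
      have h := isWeakLaplacian_laplacian (contDiff_const.mul hc :
        ContDiff ℝ 2 fun x => ((C * t ^ (2 * σ) : ℝ) : ℂ) *
          profile (ballWeight d (β - 1)) σ g x t)
      convert h using 1
      funext x
      rw [← laplacian_profile hw]
      exact (InnerProductSpace.laplacian_smul (((C * t ^ (2 * σ) : ℝ) : ℂ)) hc.contDiffAt).symm
    · rw [besselTimeOp_rpow_mul (hp hh) (hn hh) (hl hh) ht, pairing_const_mul,
        ← pairing_const_mul, ← pairing_const_mul,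
        ← pairing_add ((dA.memLp t).const_mul _) ((dA'.memLp t).const_mul _) hh]
      rfl
  · exact tendsto_rpow_mul_zero hσ (hp hh) (hn hh)
  · have h' := tendsto_fracTimeDeriv_rpow_mul hσ (hp hh) (hn hh) (hl hh 0).continuousAt
    simp_rw [profile_zero] at h'
    rw [pairing_const_mul, ← mul_assoc, ← Complex.ofReal_mul, hC, Complex.ofReal_one,
      one_mul] at h'
    exact h'

end Solution

end WaveExtension

theorem theorem4 (d : ℕ) (hd : d = 3 ∨ d = 4 ∨ d = 5) (σ : ℝ) (hσ0 : 0 < σ) (hσ1 : σ < 1)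
    (hdσ1 : 1 < (d : ℝ) / 2 - σ) (hdσ2 : (d : ℝ) / 2 - σ < 2)
    (g : 𝓢(EuclideanSpace ℝ (Fin d), ℂ)) :
    (∀ (x : EuclideanSpace ℝ (Fin d)) (t : ℝ), 0 < t →
      IntegrableOn (WaveExtension.kernelIntegrand σ g x t) (Metric.ball x t) volume) ∧
    ∀ u : EuclideanSpace ℝ (Fin d) → ℝ → ℂ,
      (∀ (x : EuclideanSpace ℝ (Fin d)) (t : ℝ), 0 < t →
        u x t = ((WaveExtension.kernelConst d σ * (1 / t ^ 2) : ℝ) : ℂ) *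
          ∫ y in Metric.ball x t, WaveExtension.kernelIntegrand σ g x t y) →
      WaveExtension.IsClassicalNeumannSolution σ g u ∧
      WaveExtension.IsWeakNeumannSolution σ g u := by
  have hd0 : 0 < d := by omega
  refine ⟨fun x t ht => WaveExtension.integrableOn_kernelIntegrand hd0 hdσ2 g x ht,
    fun u hu => ?_⟩
  -- Here β = 2 + σ - d/2; the two bounds on d/2 - σ say exactly that 0 < β < 1.
  have hβ : 2 + σ - (d : ℝ) / 2 - 1 = -((d : ℝ) / 2 - σ - 1) := by ring
  have hC := WaveExtension.kernelConst_mul_integral_ballWeight hd0 hσ0 hσ1 hdσ1 hdσ2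
  have hu' : ∀ x t, 0 < t → u x t = ((WaveExtension.kernelConst d σ * t ^ (2 * σ) : ℝ) : ℂ) *
      WaveExtension.profile (WaveExtension.ballWeight d (2 + σ - (d : ℝ) / 2 - 1)) σ g x t := by
    intro x t ht
    rw [hβ, hu x t ht, WaveExtension.kernel_representation_eq hd0 hdσ2 g x ht]
  rw [← hβ] at hC
  exact ⟨WaveExtension.isClassicalNeumannSolution_profile hd0 hσ0 (by linarith) (by linarith)
      (by ring) hC g hu',
    WaveExtension.isWeakNeumannSolution_profile hd0 hσ0 (by linarith) (by linarith)
      (by ring) hC g hu'⟩
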